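/- Let $N\ge 1$ be an integer and let $p,a,b$ be real numbers with $2\le p<N$, $1-N\le b<\frac{N(1-p)}{p}$, $b-a+1>0$ and $$b+(p-1)a+1=\frac{Npb}{N-p}+\frac{p^2(N-1)}{N-p}.$$ Put $c=\frac{(p-1)a+b+1}{p}$ and $K=\frac{-b-(p-1)a-(p-1)(N-1)}{p}$. For a real number $s$ write $$\|f\|_{L^p_s}=\Big(\int_{\mathbb R^N}|x|^{-ps}|f|^p\,dx\Big)^{1/p},\qquad \|u\|_{H^p_s}=\|\nabla u\|_{L^p_s},$$ where $\nabla u$ and $\Delta u$ are taken in the sense of distributions on $\mathbb R^N\setminus\{0\}$. Let $\mathcal H^{p,p}_{b,a}$ be the closure of $C_c^\infty(\mathbb R^N\setminus\{0\})$ under the norm $\|\Delta u\|_{L^p_b}+\|u\|_{H^p_a}$. Then there exists a constant $C>0$, depending only on $N,p,a,b$, such that every radial function $u\in\mathcal H^{p,p}_{b,a}$ satisfies $\|u\|_{H^p_c}<\infty$ and $$\|\Delta u\|_{L^p_b}\,\|u\|_{H^p_a}^{p-1}-K\,\|u\|_{H^p_c}^p\;\ge\; C\inf_{v\in\mathcal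 M^2_{p,a,b}}\|u-v\|_{H^p_c}^p,$$ where $$\mathcal M^2_{p,a,b}=\Big\{v(x)=\Lambda\int_{|x|}^\infty r^{1-N}\exp\Big(-\frac{\lambda r^{b-a+1}}{b-a+1}\Big)\,dr:\ \Lambda\in\mathbb R,\ \lambda>0\Big\}.$$ -/

import Mathlib

open MeasureTheory Filter Topology Set
open scoped ENNReal ContDiff Laplacian

noncomputable section

namespace CKN

/-- `φ` belongs to `C_c^∞(ℝ^N \ {0})`. -/
def IsTest {N : ℕ} (φ : EuclideanSpace ℝ (Fin N) → ℝ) : Prop :=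
  ContDiff ℝ ∞ φ ∧ HasCompactSupport φ ∧ (0 : EuclideanSpace ℝ (Fin N)) ∉ tsupport φ

/-- `u` and `G` are locally integrable on `ℝ^N \ {0}`, and `G` is the distributional gradient of
`u` there. -/
def HasWeakGradient {N : ℕ} (u : EuclideanSpace ℝ (Fin N) → ℝ)
    (G : EuclideanSpace ℝ (Fin N) → EuclideanSpace ℝ (Fin N)) : Prop :=
  LocallyIntegrableOn u {0}ᶜ volume ∧ LocallyIntegrableOn G {0}ᶜ volume ∧
    ∀ φ : EuclideanSpace ℝ (Fin N) → ℝ, IsTest φ →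
      ∫ x, u x • gradient φ x = -∫ x, φ x • G x

/-- `u` and `L` are locally integrable on `ℝ^N \ {0}`, and `L` is the distributional Laplacian of
`u` there. -/
def HasWeakLaplacian {N : ℕ} (u L : EuclideanSpace ℝ (Fin N) → ℝ) : Prop :=
  LocallyIntegrableOn u {0}ᶜ volume ∧ LocallyIntegrableOn L {0}ᶜ volume ∧
    ∀ φ : EuclideanSpace ℝ (Fin N) → ℝ, IsTest φ →
      ∫ x, u x * (Δ φ) x = ∫ x, φ x * L x

/-- The weighted norm `‖f‖_{L^p_a} = (∫ |x|^{-pa} |f|^p dx)^{1/p}`, as an extended real: it is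
the unweighted `L^p` norm of `|x|^{-a} f`. -/
def weightedNorm {N : ℕ} {F : Type*} [NormedAddCommGroup F] [NormedSpace ℝ F] (p a : ℝ)
    (f : EuclideanSpace ℝ (Fin N) → F) : ℝ≥0∞ :=
  eLpNorm (fun x => ‖x‖ ^ (-a) • f x) (ENNReal.ofReal p) volume

/-- `‖u‖_{H^p_a} = ‖∇u‖_{L^p_a}`. The weak gradient is unique almost everywhere, so that the
infimum has only one value to run over; it is `∞` if `u` has no weak gradient. -/
def hNorm {N : ℕ} (p a : ℝ) (u : EuclideanSpace ℝ (Fin N) → ℝ) : ℝ≥0∞ :=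
  ⨅ (G : EuclideanSpace ℝ (Fin N) → EuclideanSpace ℝ (Fin N)) (_ : HasWeakGradient u G),
    weightedNorm p a G

/-- `‖Δu‖_{L^p_b}`. The weak Laplacian is unique almost everywhere, so that the infimum has only
one value to run over; it is `∞` if `Δu` is not a locally integrable function on `ℝ^N \ {0}`. -/
def laplacianNorm {N : ℕ} (p b : ℝ) (u : EuclideanSpace ℝ (Fin N) → ℝ) : ℝ≥0∞ :=
  ⨅ (L : EuclideanSpace ℝ (Fin N) → ℝ) (_ : HasWeakLaplacian u L), weightedNorm p b L

/-- `u ∈ 𝓗^{p,q}_{b,a}`: `u` is in the closure of `C_c^∞(ℝ^N \ {0})` under the norm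
`‖Δu‖_{L^p_b} + ‖u‖_{H^q_a}`. -/
def MemSecondOrderSpace {N : ℕ} (p q b a : ℝ) (u : EuclideanSpace ℝ (Fin N) → ℝ) : Prop :=
  ∃ φ : ℕ → EuclideanSpace ℝ (Fin N) → ℝ, (∀ n, IsTest (φ n)) ∧
    Tendsto (fun n => laplacianNorm p b (u - φ n) + hNorm q a (u - φ n)) atTop (𝓝 0)

/-- `u` agrees almost everywhere with a function of `|x|`. -/
def IsRadial {N : ℕ} (u : EuclideanSpace ℝ (Fin N) → ℝ) : Prop :=
  ∃ f : ℝ → ℝ, ∀ᵐ x, u x = f ‖x‖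

/-- The functions
`v(x) = Λ ∫_{|x|}^∞ r^{1-N} exp(-λ r^{b-a+1} / (b-a+1)) dr` with `Λ ∈ ℝ` and `λ > 0`. -/
def minimizers (N : ℕ) (a b : ℝ) : Set (EuclideanSpace ℝ (Fin N) → ℝ) :=
  {v | ∃ Λ lam : ℝ, 0 < lam ∧ v = fun x => Λ * ∫ r in Ioi ‖x‖,
    r ^ (1 - (N : ℝ)) * Real.exp (-(lam * r ^ (b - a + 1)) / (b - a + 1))}

end CKN

end

/-! The problem is one-dimensional. For radial `u` with profile `f`, put `w = r ^ (N-1) f'`, so that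
`w' = r ^ (N-1) Δu`. With `β = b-a+1` and `θ = pK`, polar coordinates turn the `p`-th powers of the
norms of `Δu` in `L^p_b` and of `∇u` in `L^p_a` and `L^p_c`, up to the area of the sphere, into `A =
∫ r^(θ+β-1) |r^(1-β) w'|^p`, `B = ∫ r^(θ+β-1) |w|^p` and `D = ∫ r^(θ-1) |w|^p`. The balance
condition and the upper bound on `b` serve to give `θ > 0`.

Apply Young's inequality to `r^(1-β) w'` and `-λ w` and integrate. The cross term is part of the
derivative of `r^θ |w|^p`, so integration by parts gives `λ^(p-1) (θ/p) D ≤ A/p + λ^p (1-1/p) B`.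
The choice `λ = (A/B)^(1/p)` turns this into `(θ/p) D ≤ A^(1/p) B^(1-1/p)`, which is the sharp
inequality.

For stability, keep the defect in Young's inequality: for `p ≥ 2` it dominates `|r^(1-β) w' + λ
w|^p` (`young_deficit`, `deficit`). The first-order operator in this expression annihilates exactly
the multiples of `exp(-λ r^β/β)`, and these are the functions `r^(N-1) v'` for `v` in the family of
extremals. Subtract from `w` the multiple that agrees with it at a suitable point `r₀`; the
difference is controlled by a weighted Poincaré inequality (`exists_poincare`), whose constant
scales like `λ^(1-p)` and so cancels the factor `λ^(p-1)`. This is `exists_stability_half_line`.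

To return to `ℝ^N`, testing with radial fields shows that spherical means satisfy the expected weak
equations on the half-line, and the du Bois-Reymond lemma gives a `C^1` profile
(`exists_radial_profile`). Jensen's inequality bounds `A` and `B` by the norms on `ℝ^N`. The closure
of the test functions enters only through finiteness of the two norms
(`MemSecondOrderSpace.ne_top`). -/

namespace CKN

/-! ### Elementary power inequalities and the defect in Young's inequality -/

/-- `t ^ (p-1) s ≤ ε t ^ p + ε ^ (1-p) s ^ p`, an elementary form of Young's inequality. -/
theorem rpow_sub_one_mul_le {p ε t s : ℝ} (hp : 2 ≤ p) (hε : 0 < ε) (ht : 0 ≤ t) (hs : 0 ≤ s) :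
    t ^ (p - 1) * s ≤ ε * t ^ p + ε ^ (1 - p) * s ^ p := by
  rcases le_total s (ε * t) with h | h
  · have h1 : t ^ (p - 1) * s ≤ t ^ (p - 1) * (ε * t) := by gcongr
    have h2 : t ^ (p - 1) * (ε * t) = ε * t ^ p := by
      have : t ^ p = t ^ (p - 1) * t := by
        rw [← Real.rpow_add_one' ht (by linarith)]; ring_nf
      rw [this]; ring
    have : 0 ≤ ε ^ (1 - p) * s ^ p := by positivity
    linarith
  · have h0 : t ≤ ε⁻¹ * s := by
      rw [inv_mul_eq_div, le_div_iff₀ hε]; linarith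
    have h1 : t ^ (p - 1) * s ≤ (ε⁻¹ * s) ^ (p - 1) * s := by
      gcongr; linarith
    have h2 : (ε⁻¹ * s) ^ (p - 1) * s = ε ^ (1 - p) * s ^ p := by
      have : s ^ p = s ^ (p - 1) * s := by
        rw [← Real.rpow_add_one' hs (by linarith)]; ring_nf
      rw [this, Real.mul_rpow (by positivity) hs, Real.inv_rpow hε.le, ← Real.rpow_neg hε.le]
      ring_nf
    have : 0 ≤ ε * t ^ p := by positivity
    linarith

theorem abs_add_rpow_le {p : ℝ} (hp : 1 ≤ p) (x y : ℝ) :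
    |x + y| ^ p ≤ 2 ^ (p - 1) * (|x| ^ p + |y| ^ p) := by
  have h1 : |x + y| ^ p ≤ (|x| + |y|) ^ p := by
    gcongr; exact abs_add_le x y
  refine h1.trans ?_
  have h2 := (convexOn_rpow hp).2 (abs_nonneg x) (abs_nonneg y)
    (by norm_num : (0 : ℝ) ≤ 1 / 2) (by norm_num : (0 : ℝ) ≤ 1 / 2) (by norm_num)
  simp only [smul_eq_mul] at h2
  rw [show (1/2 * |x| + 1/2 * |y|) = 2⁻¹ * (|x| + |y|) by ring, Real.mul_rpow (by norm_num)
    (by positivity), Real.inv_rpow (by norm_num)] at h2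
  rw [Real.rpow_sub_one (by norm_num)]
  have h3 : (0 : ℝ) < 2 ^ p := by positivity
  rw [inv_mul_le_iff₀ h3] at h2
  linarith

theorem abs_rpow_sub_two_mul_self_mul_le (p x y : ℝ) :
    |y| ^ (p - 2) * y * x ≤ |y| ^ (p - 1) * |x| := by
  rcases eq_or_ne y 0 with rfl | hy
  · simp; positivity
  have : |y| ^ (p - 1) = |y| ^ (p - 2) * |y| := by
    rw [← Real.rpow_add_one (abs_ne_zero.2 hy)]; ring_nf
  rw [this, mul_assoc, mul_assoc, ← abs_mul]
  gcongr
  exact le_abs_self _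

theorem abs_rpow_sub_two_mul_self_mul_self {p : ℝ} (hp : 2 ≤ p) (y : ℝ) :
    |y| ^ (p - 2) * y * y = |y| ^ p := by
  rw [mul_assoc, ← abs_mul_abs_self, ← mul_assoc, ← Real.rpow_add_one' (abs_nonneg _) (by linarith),
    ← Real.rpow_add_one' (abs_nonneg _) (by linarith)]
  ring_nf

/-- Clarkson's inequality for real numbers and `p ≥ 2`. -/
theorem clarkson_real {p : ℝ} (hp : 2 ≤ p) (x y : ℝ) :
    |(x + y) / 2| ^ p + |(x - y) / 2| ^ p ≤ (|x| ^ p + |y| ^ p) / 2 := by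
  have key : ∀ t : ℝ, |t| ^ p = (t ^ 2) ^ (p / 2) := by
    intro t
    rw [← sq_abs, ← Real.rpow_natCast, ← Real.rpow_mul (abs_nonneg _)]
    congr 1; push_cast; ring
  simp only [key]
  -- Superadditivity of `s ^ (p/2)`, then the parallelogram law, then convexity; both need `p / 2 ≥
  -- 1`.
  have h1 := Real.add_rpow_le_rpow_add (sq_nonneg ((x + y) / 2)) (sq_nonneg ((x - y) / 2))
    (p := p / 2) (by linarith)
  refine h1.trans ?_
  have h2 := (convexOn_rpow (p := p / 2) (by linarith)).2 (sq_nonneg x) (sq_nonneg y)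
    (by norm_num : (0 : ℝ) ≤ 1 / 2) (by norm_num : (0 : ℝ) ≤ 1 / 2) (by norm_num)
  simp only [smul_eq_mul] at h2
  rw [show ((x + y) / 2) ^ 2 + ((x - y) / 2) ^ 2 = 1/2 * x ^ 2 + 1/2 * y ^ 2 by ring]
  linarith

/-- The defect in Young's inequality controls `|x - y| ^ p` when `p ≥ 2`. -/
theorem young_deficit {p : ℝ} (hp : 2 ≤ p) (x y : ℝ) :
    2 ^ (1 - p) / p * |x - y| ^ p ≤
      |x| ^ p / p + (1 - 1 / p) * |y| ^ p - |y| ^ (p - 2) * y * x := by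
  have hp0 : 0 < p := by linarith
  have h1 := clarkson_real hp x y
  -- Young's inequality is applied at the midpoint `(x + y) / 2` instead of `x`. The cross term is
  -- linear in that variable, so the strict convexity gain in Clarkson's inequality becomes the
  -- defect at `x`.
  have hY : |y| ^ (p - 2) * y * ((x + y) / 2) ≤ |(x + y) / 2| ^ p / p + (1 - 1 / p) * |y| ^ p := by
    have hq : p.HolderConjugate (p / (p - 1)) := Real.HolderConjugate.conjExponent (by linarith)
    have h2 := Real.young_inequality_of_nonneg (abs_nonneg ((x + y) / 2))
      (by positivity : 0 ≤ |y| ^ (p - 1)) hq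
    have h3 := abs_rpow_sub_two_mul_self_mul_le p ((x + y) / 2) y
    rw [← Real.rpow_mul (abs_nonneg _), mul_div_cancel₀ _ (by linarith : p - 1 ≠ 0)] at h2
    have : |y| ^ p / (p / (p - 1)) = (1 - 1 / p) * |y| ^ p := by
      field_simp
    rw [this] at h2
    linarith
  have h4 : |y| ^ (p - 2) * y * ((x + y) / 2) =
      (|y| ^ (p - 2) * y * x + |y| ^ p) / 2 := by
    rw [← abs_rpow_sub_two_mul_self_mul_self hp y]; ring
  have h5 : |(x - y) / 2| ^ p = 2 ^ (1 - p) / 2 * |x - y| ^ p := by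
    rw [abs_div, Real.div_rpow (abs_nonneg _) (abs_nonneg _), Real.rpow_sub two_pos, abs_two]
    simp; ring
  rw [h4] at hY
  rw [h5] at h1
  have h6 : (2 / p) * (|(x + y) / 2| ^ p + 2 ^ (1 - p) / 2 * |x - y| ^ p) ≤
      (2 / p) * ((|x| ^ p + |y| ^ p) / 2) := by gcongr
  have h7 : 2 ^ (1 - p) / p * |x - y| ^ p = (2 / p) * (2 ^ (1 - p) / 2 * |x - y| ^ p) := by
    field_simp
  have h8 : |(x + y) / 2| ^ p / p = 1 / 2 * ((2 / p) * |(x + y) / 2| ^ p) := by field_simp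
  rw [h7]
  have h9 : (2 / p) * ((|x| ^ p + |y| ^ p) / 2) = |x| ^ p / p + 1 / p * |y| ^ p := by
    field_simp
  rw [h9, mul_add] at h6
  rw [h8] at hY
  linarith

/-! ### Locally absolutely continuous functions on the half-line -/

theorem _root_.AbsolutelyContinuousOnInterval.lipschitzOnWith_comp {f : ℝ → ℝ} {g : ℝ → ℝ}
    {a b : ℝ} {s : Set ℝ} {C : NNReal} (hf : AbsolutelyContinuousOnInterval f a b)
    (hg : LipschitzOnWith C g s) (hs : MapsTo f (uIcc a b) s) :
    AbsolutelyContinuousOnInterval (fun x => g (f x)) a b := by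
  rw [absolutelyContinuousOnInterval_iff] at hf ⊢
  intro ε hε
  obtain ⟨δ, hδ, H⟩ := hf (ε / (C + 1)) (by positivity)
  refine ⟨δ, hδ, fun E hE hlt => ?_⟩
  calc ∑ i ∈ Finset.range E.1, dist (g (f (E.2 i).1)) (g (f (E.2 i).2))
      ≤ ∑ i ∈ Finset.range E.1, C * dist (f (E.2 i).1) (f (E.2 i).2) :=
        Finset.sum_le_sum fun i hi => hg.dist_le_mul _ (hs (hE.1 i hi).1) _ (hs (hE.1 i hi).2)
    _ = C * ∑ i ∈ Finset.range E.1, dist (f (E.2 i).1) (f (E.2 i).2) := by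
        rw [Finset.mul_sum]
    _ ≤ C * (ε / (C + 1)) := by gcongr; exact (H E hE hlt).le
    _ < (C + 1) * (ε / (C + 1)) := by gcongr; linarith
    _ = ε := by field

/-- For `p > 1` the function `|·| ^ p` is `C^1`, hence Lipschitz on the bounded range of `f`. -/
theorem _root_.AbsolutelyContinuousOnInterval.abs_rpow {f : ℝ → ℝ} {a b p : ℝ} (hp : 1 < p)
    (hf : AbsolutelyContinuousOnInterval f a b) :
    AbsolutelyContinuousOnInterval (fun x => |f x| ^ p) a b := by
  obtain ⟨C, hC⟩ := hf.exists_bound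
  have h0 : ContDiff ℝ 1 (fun x : ℝ => |x| ^ p) := by
    simpa only [Real.norm_eq_abs] using contDiff_norm_rpow (E := ℝ) hp
  have h1 : ContDiffOn ℝ 1 (fun x : ℝ => |x| ^ p) (Icc (-C) C) := h0.contDiffOn
  obtain ⟨L, hL⟩ := h1.exists_lipschitzOnWith one_ne_zero (convex_Icc (-C) C) isCompact_Icc
  have hs : MapsTo f (uIcc a b) (Icc (-C) C) := fun x hx => by
    have := hC x hx
    rwa [Real.norm_eq_abs, abs_le] at this
  exact hf.lipschitzOnWith_comp (g := fun x : ℝ => |x| ^ p) hL hs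

/-- `w` is a locally absolutely continuous function on `(0, ∞)` with derivative `k`. -/
structure IsPrimitive (w k : ℝ → ℝ) : Prop where
  intervalIntegrable : ∀ a b, 0 < a → 0 < b → IntervalIntegrable k volume a b
  sub_eq : ∀ a b, 0 < a → 0 < b → w b - w a = ∫ x in a..b, k x

namespace IsPrimitive

variable {w k : ℝ → ℝ} {a b : ℝ}

theorem eqOn (h : IsPrimitive w k) (ha : 0 < a) :
    EqOn w (fun x => w a + ∫ t in a..x, k t) (Ioi 0) := fun x hx => by
  simp [← h.sub_eq a x ha hx]

theorem _root_.CKN.uIcc_subset_Ioi (ha : 0 < a) (hb : 0 < b) : uIcc a b ⊆ Ioi 0 :=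
  fun _ hx => (lt_min ha hb).trans_le hx.1

theorem absolutelyContinuousOnInterval (h : IsPrimitive w k) (ha : 0 < a) (hb : 0 < b) :
    AbsolutelyContinuousOnInterval w a b := by
  have h1 := (h.intervalIntegrable a b ha hb).absolutelyContinuousOnInterval_intervalIntegral
    left_mem_uIcc
  have h2 : AbsolutelyContinuousOnInterval (fun _ : ℝ => w a) a b :=
    contDiffOn_const.absolutelyContinuousOnInterval
  have h3 := h2.fun_add h1
  have h4 : EqOn w (fun x => w a + ∫ t in a..x, k t) (uIcc a b) :=
    (h.eqOn ha).mono (uIcc_subset_Ioi ha hb)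
  rw [absolutelyContinuousOnInterval_iff] at h3 ⊢
  intro ε hε
  obtain ⟨δ, hδ, H⟩ := h3 ε hε
  refine ⟨δ, hδ, fun E hE hlt => ?_⟩
  convert H E hE hlt using 1
  refine Finset.sum_congr rfl fun i hi => ?_
  rw [h4 (hE.1 i hi).1, h4 (hE.1 i hi).2]

theorem continuousOn (h : IsPrimitive w k) : ContinuousOn w (Ioi 0) := by
  intro x hx
  have hx' : (0 : ℝ) < x := hx
  have h1 := (h.absolutelyContinuousOnInterval (a := x / 2) (b := 2 * x) (by linarith)
    (by linarith)).continuousOn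
  rw [uIcc_of_le (by linarith)] at h1
  exact (h1.continuousAt (Icc_mem_nhds (by linarith) (by linarith))).continuousWithinAt

theorem ae_hasDerivAt (h : IsPrimitive w k) (ha : 0 < a) (hb : 0 < b) :
    ∀ᵐ x, x ∈ uIcc a b → HasDerivAt w (k x) x := by
  filter_upwards [(h.intervalIntegrable a b ha hb).ae_hasDerivAt_integral] with x hx hxab
  have hx0 : 0 < x := uIcc_subset_Ioi ha hb hxab
  refine ((hx hxab a left_mem_uIcc).const_add (w a)).congr_of_eventuallyEq ?_
  filter_upwards [Ioi_mem_nhds hx0] with y hy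
  exact h.eqOn ha hy

theorem of_hasDerivAt (hw : ∀ x, 0 < x → HasDerivAt w (k x) x) (hk : ContinuousOn k (Ioi 0)) :
    IsPrimitive w k where
  intervalIntegrable _ _ ha hb := (hk.mono (uIcc_subset_Ioi ha hb)).intervalIntegrable
  sub_eq _ _ ha hb := (intervalIntegral.integral_eq_sub_of_hasDerivAt
    (fun x hx => hw x (uIcc_subset_Ioi ha hb hx))
    (hk.mono (uIcc_subset_Ioi ha hb)).intervalIntegrable).symm

theorem sub {w' k' : ℝ → ℝ} (h : IsPrimitive w k) (h' : IsPrimitive w' k') :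
    IsPrimitive (fun x => w x - w' x) (fun x => k x - k' x) where
  intervalIntegrable a b ha hb :=
    (h.intervalIntegrable a b ha hb).sub (h'.intervalIntegrable a b ha hb)
  sub_eq a b ha hb := by
    rw [intervalIntegral.integral_sub (h.intervalIntegrable a b ha hb)
      (h'.intervalIntegrable a b ha hb), ← h.sub_eq a b ha hb, ← h'.sub_eq a b ha hb]
    ring

/-- The fundamental theorem of calculus for `H |w| ^ p`. -/
theorem integral_weight_mul_abs_rpow (h : IsPrimitive w k) {p : ℝ} (hp : 2 ≤ p) {H H' : ℝ → ℝ}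
    (hH : ∀ x, 0 < x → HasDerivAt H (H' x) x) (hH' : ContinuousOn H' (Ioi 0))
    (ha : 0 < a) (hb : 0 < b) :
    IntervalIntegrable (fun x => H' x * |w x| ^ p + H x * (p * (|w x| ^ (p - 2) * w x * k x)))
      volume a b ∧
    ∫ x in a..b, (H' x * |w x| ^ p + H x * (p * (|w x| ^ (p - 2) * w x * k x))) =
      H b * |w b| ^ p - H a * |w a| ^ p := by
  have hwc : ContinuousOn w (uIcc a b) := h.continuousOn.mono (uIcc_subset_Ioi ha hb)
  have hHc : ContinuousOn H (uIcc a b) := fun x hx =>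
    (hH x (uIcc_subset_Ioi ha hb hx)).continuousAt.continuousWithinAt
  have hH'c : ContinuousOn H' (uIcc a b) := hH'.mono (uIcc_subset_Ioi ha hb)
  refine ⟨?_, ?_⟩
  · refine IntervalIntegrable.add ?_ ?_
    · exact (hH'c.mul (hwc.abs.rpow_const fun x _ => Or.inr (by linarith))).intervalIntegrable
    · have : ContinuousOn (fun x => H x * (p * (|w x| ^ (p - 2) * w x))) (uIcc a b) :=
        hHc.mul (continuousOn_const.mul
          ((hwc.abs.rpow_const fun x _ => Or.inr (by linarith)).mul hwc))
      refine ((h.intervalIntegrable a b ha hb).continuousOn_mul this).congr ?_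
      exact fun x _ => by ring
  · have hAC := ((of_hasDerivAt hH hH').absolutelyContinuousOnInterval ha hb).fun_mul
      ((h.absolutelyContinuousOnInterval ha hb).abs_rpow (p := p) (by linarith))
    rw [← hAC.integral_deriv_eq_sub]
    refine intervalIntegral.integral_congr_ae ?_
    filter_upwards [h.ae_hasDerivAt ha hb] with x hx hxab
    have hxab' := uIoc_subset_uIcc hxab
    have h1 := (hH x (uIcc_subset_Ioi ha hb hxab')).mul
      ((hasDerivAt_abs_rpow (w x) (p := p) (by linarith)).comp x (hx hxab'))
    refine (h1.deriv.trans ?_).symm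
    simp only [Function.comp]
    ring

end IsPrimitive

/-! ### Improper integrals over the half-line -/

/-- A nonnegative function on `(0, ∞)` whose integrals over arbitrarily large intervals are bounded
by `C` is integrable with integral at most `C`. -/
theorem integrableOn_Ioi_zero_of_bound {f : ℝ → ℝ} {C : ℝ} (hf : ∀ x, 0 < x → 0 ≤ f x)
    (hint : ∀ a b, 0 < a → 0 < b → IntervalIntegrable f volume a b)
    (h : ∀ ε T, 0 < ε → ε ≤ T → ∃ ε' T', 0 < ε' ∧ ε' ≤ ε ∧ T ≤ T' ∧ ∫ x in ε'..T', f x ≤ C) :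
    IntegrableOn f (Ioi 0) ∧ ∫ x in Ioi 0, f x ≤ C := by
  have hε : ∀ n : ℕ, (0 : ℝ) < 1 / ((n : ℝ) + 1) := fun n => by positivity
  have hεT : ∀ n : ℕ, 1 / ((n : ℝ) + 1) ≤ (n : ℝ) + 1 := fun n =>
    (div_le_one (by positivity)).2 (by linarith [n.cast_nonneg (α := ℝ)]) |>.trans
      (by linarith [n.cast_nonneg (α := ℝ)])
  have hcov : AECover (volume.restrict (Ioi (0 : ℝ))) atTop
      (fun n : ℕ => Ioc (1 / ((n : ℝ) + 1)) ((n : ℝ) + 1)) := by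
    refine ⟨?_, fun n => measurableSet_Ioc⟩
    filter_upwards [ae_restrict_mem measurableSet_Ioi] with x hx
    have h1 : Tendsto (fun n : ℕ => 1 / ((n : ℝ) + 1)) atTop (𝓝 0) :=
      tendsto_one_div_add_atTop_nhds_zero_nat
    have h2 : Tendsto (fun n : ℕ => (n : ℝ) + 1) atTop atTop :=
      tendsto_atTop_add_const_right _ _ tendsto_natCast_atTop_atTop
    filter_upwards [h1.eventually_lt_const hx, h2.eventually_ge_atTop x] with n hn1 hn2
    exact ⟨hn1, hn2⟩
  have hI : ∀ n : ℕ, IntegrableOn f (Ioc (1 / ((n : ℝ) + 1)) ((n : ℝ) + 1)) := fun n =>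
    (intervalIntegrable_iff_integrableOn_Ioc_of_le (hεT n)).1
      (hint _ _ (hε n) ((hε n).trans_le (hεT n)))
  have hres : ∀ n : ℕ, (volume.restrict (Ioi (0 : ℝ))).restrict
      (Ioc (1 / ((n : ℝ) + 1)) ((n : ℝ) + 1)) =
      volume.restrict (Ioc (1 / ((n : ℝ) + 1)) ((n : ℝ) + 1)) := fun n => by
    rw [Measure.restrict_restrict measurableSet_Ioc, inter_eq_left.2]
    exact fun x hx => (hε n).trans hx.1
  have hle : ∀ n : ℕ, ∫ x in Ioc (1 / ((n : ℝ) + 1)) ((n : ℝ) + 1), f x ≤ C := by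
    intro n
    obtain ⟨ε', T', h0, h1, h2, h3⟩ := h _ _ (hε n) (hεT n)
    rw [intervalIntegral.integral_of_le (h1.trans ((hεT n).trans h2))] at h3
    refine le_trans (setIntegral_mono_set ?_ ?_ ?_) h3
    · exact (intervalIntegrable_iff_integrableOn_Ioc_of_le (h1.trans ((hεT n).trans h2))).1
        (hint _ _ h0 (h0.trans_le (h1.trans ((hεT n).trans h2))))
    · filter_upwards [ae_restrict_mem measurableSet_Ioc] with x hx
      exact hf x (h0.trans hx.1)
    · exact (Ioc_subset_Ioc h1 h2).eventuallyLE
  have hf' : ∀ᵐ x ∂(volume.restrict (Ioi (0 : ℝ))), 0 ≤ f x := by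
    filter_upwards [ae_restrict_mem measurableSet_Ioi] with x hx using hf x hx
  have hfi : IntegrableOn f (Ioi 0) := by
    refine hcov.integrable_of_integral_bounded_of_nonneg_ae C (fun n => ?_) hf' (.of_forall ?_)
    · rw [IntegrableOn, hres]; exact hI n
    · intro n; rw [hres]; exact hle n
  refine ⟨hfi, ?_⟩
  refine le_of_tendsto (hcov.integral_tendsto_of_countably_generated hfi) (.of_forall fun n => ?_)
  rw [hres]; exact hle n

theorem _root_.MeasureTheory.IntegrableOn.intervalIntegrable_of_pos {f : ℝ → ℝ} {a b : ℝ}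
    (h : IntegrableOn f (Ioi 0)) (ha : 0 < a) (hb : 0 < b) : IntervalIntegrable f volume a b :=
  intervalIntegrable_iff.2 (h.mono_set (uIoc_subset_uIcc.trans (uIcc_subset_Ioi ha hb)))

theorem intervalIntegral_le_integral_Ioi {f : ℝ → ℝ} {a b : ℝ} (hf : ∀ x, 0 < x → 0 ≤ f x)
    (h : IntegrableOn f (Ioi 0)) (ha : 0 < a) (hab : a ≤ b) :
    ∫ x in a..b, f x ≤ ∫ x in Ioi 0, f x := by
  rw [intervalIntegral.integral_of_le hab]
  refine setIntegral_mono_set h ?_ ?_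
  · filter_upwards [ae_restrict_mem measurableSet_Ioi] with x hx using hf x hx
  · exact (show Ioc a b ⊆ Ioi 0 from fun x hx => ha.trans hx.1).eventuallyLE

theorem IsPrimitive.locallyIntegrableOn {w k : ℝ → ℝ} (h : IsPrimitive w k) :
    LocallyIntegrableOn k (Ioi 0) := by
  intro x hx
  have hx' : (0 : ℝ) < x := hx
  refine ⟨Ioc (x / 2) (2 * x), mem_nhdsWithin_of_mem_nhds
    (Ioc_mem_nhds (by linarith) (by linarith)), ?_⟩
  exact (intervalIntegrable_iff_integrableOn_Ioc_of_le (by linarith)).1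
    (h.intervalIntegrable _ _ (by linarith) (by linarith))

theorem IsPrimitive.aestronglyMeasurable {w k : ℝ → ℝ} (h : IsPrimitive w k) :
    AEStronglyMeasurable k (volume.restrict (Ioi 0)) :=
  h.locallyIntegrableOn.aestronglyMeasurable

theorem continuousOn_rpow_Ioi (q : ℝ) : ContinuousOn (fun r : ℝ => r ^ q) (Ioi 0) :=
  continuousOn_id.rpow_const fun _ hx => Or.inl (ne_of_gt hx)

theorem IsPrimitive.continuousOn_rpow_mul {w k : ℝ → ℝ} (h : IsPrimitive w k) {p : ℝ}
    (hp : 0 ≤ p) (q : ℝ) : ContinuousOn (fun r : ℝ => r ^ q * |w r| ^ p) (Ioi 0) :=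
  (continuousOn_rpow_Ioi q).mul (h.continuousOn.abs.rpow_const fun _ _ => Or.inr hp)

/-- If `r^θ |w|^p` stayed above `η` near infinity, `r^(β-1)` would be integrable there, which fails
for `β > 0`. This makes the boundary term at infinity negligible along suitable endpoints, without a
pointwise decay estimate. -/
theorem exists_ge_rpow_mul_le {p θ β η T₀ : ℝ} {w : ℝ → ℝ} (hβ : 0 < β)
    (hB : IntegrableOn (fun r : ℝ => r ^ (θ + β - 1) * |w r| ^ p) (Ioi 0)) (hη : 0 < η)
    (hT : 0 < T₀) : ∃ T, T₀ ≤ T ∧ T ^ θ * |w T| ^ p ≤ η := by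
  by_contra! hcon
  have h1 : IntegrableOn (fun r : ℝ => r ^ (β - 1)) (Ioi T₀) := by
    refine Integrable.mono' (g := fun r => η⁻¹ * (r ^ (θ + β - 1) * |w r| ^ p))
      ((hB.mono_set (Ioi_subset_Ioi hT.le)).const_mul _) ?_ ?_
    · exact ((continuousOn_rpow_Ioi _).mono (Ioi_subset_Ioi hT.le)).aestronglyMeasurable
        measurableSet_Ioi
    · filter_upwards [ae_restrict_mem measurableSet_Ioi] with r hr
      have hr0 : 0 < r := hT.trans hr
      rw [Real.norm_of_nonneg (by positivity), inv_mul_eq_div, le_div_iff₀ hη,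
        show θ + β - 1 = (β - 1) + θ by ring, Real.rpow_add hr0, mul_assoc]
      gcongr
      exact (hcon r (le_of_lt hr)).le
  rw [integrableOn_Ioi_rpow_iff hT] at h1
  linarith

/-! ### The sharp inequality on the half-line with its remainder -/

section

variable {p θ β : ℝ} {w k : ℝ → ℝ}

/-- This is `young_deficit` with `x = r^(1-β) k` and `y = -λ w`, multiplied by `r^(θ+β-1)`. The
weight turns the cross term into `λ^(p-1) r^θ |w|^(p-2) w k`, and adding the missing multiple of
`r^(θ-1) |w|^p` on both sides completes the derivative of `r^θ |w|^p`. -/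
theorem deficit_pointwise (hp : 2 ≤ p) {lam r : ℝ} (hlam : 0 < lam) (hr : 0 < r) (w k : ℝ) :
    2 ^ (1 - p) / p * (r ^ (θ + β - 1) * |r ^ (1 - β) * k + lam * w| ^ p) +
      lam ^ (p - 1) * (θ / p) * (r ^ (θ - 1) * |w| ^ p) ≤
    1 / p * (r ^ (θ + β - 1) * |r ^ (1 - β) * k| ^ p) +
      lam ^ p * (1 - 1 / p) * (r ^ (θ + β - 1) * |w| ^ p) +
      lam ^ (p - 1) / p *
        (θ * r ^ (θ - 1) * |w| ^ p + r ^ θ * (p * (|w| ^ (p - 2) * w * k))) := by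
  have hp0 : 0 < p := by linarith
  have h1 := young_deficit hp (r ^ (1 - β) * k) (-(lam * w))
  rw [sub_neg_eq_add, abs_neg, abs_mul lam, abs_of_pos hlam, Real.mul_rpow hlam.le (abs_nonneg _),
    Real.mul_rpow hlam.le (abs_nonneg _)] at h1
  have h2 : lam ^ (p - 1) = lam ^ (p - 2) * lam := by
    rw [← Real.rpow_add_one hlam.ne']; ring_nf
  have h3 : r ^ θ = r ^ (θ + β - 1) * r ^ (1 - β) := by
    rw [← Real.rpow_add hr]; ring_nf
  have h4 := mul_le_mul_of_nonneg_left h1 (by positivity : 0 ≤ r ^ (θ + β - 1))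
  rw [h2, h3]
  have h5 : lam ^ (p - 2) * lam / p * (θ * r ^ (θ - 1) * |w| ^ p +
      r ^ (θ + β - 1) * r ^ (1 - β) * (p * (|w| ^ (p - 2) * w * k))) =
      lam ^ (p - 2) * lam * (θ / p) * (r ^ (θ - 1) * |w| ^ p) +
      lam ^ (p - 2) * lam * (r ^ (θ + β - 1) * r ^ (1 - β) * ((|w| ^ (p - 2) * w * k))) := by
    field_simp
  rw [h5]
  -- Once the powers are treated as atoms, the claim is a linear consequence of `h4`.
  clear h1 h2 h3 h5
  generalize (2 : ℝ) ^ (1 - p) / p = c at *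
  generalize |r ^ (1 - β) * k + lam * w| ^ p = P at *
  generalize |r ^ (1 - β) * k| ^ p = A at *
  generalize |w| ^ p = B at *
  generalize |w| ^ (p - 2) = B' at *
  generalize lam ^ p = l at *
  generalize lam ^ (p - 2) = l' at *
  generalize r ^ (θ + β - 1) = M at *
  generalize r ^ (1 - β) = M' at *
  generalize r ^ (θ - 1) = M'' at *
  linear_combination h4

/-- The pointwise bound integrated over `(0, ∞)`, where the total derivative contributes nothing
positive in the limit. Integrability of `r^(θ-1) |w|^p` is an outcome here, and `λ` stays free to be
optimised later. -/
theorem deficit (hp : 2 ≤ p) (hθ : 0 < θ) (hβ : 0 < β) (h : IsPrimitive w k)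
    (hA : IntegrableOn (fun r : ℝ => r ^ (θ + β - 1) * |r ^ (1 - β) * k r| ^ p) (Ioi 0))
    (hB : IntegrableOn (fun r : ℝ => r ^ (θ + β - 1) * |w r| ^ p) (Ioi 0))
    {lam : ℝ} (hlam : 0 < lam) :
    IntegrableOn (fun r : ℝ => r ^ (θ - 1) * |w r| ^ p) (Ioi 0) ∧
    IntegrableOn (fun r : ℝ => r ^ (θ + β - 1) * |r ^ (1 - β) * k r + lam * w r| ^ p) (Ioi 0) ∧
    2 ^ (1 - p) / p *
        (∫ r in Ioi (0 : ℝ), r ^ (θ + β - 1) * |r ^ (1 - β) * k r + lam * w r| ^ p) +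
      lam ^ (p - 1) * (θ / p) * ∫ r in Ioi (0 : ℝ), r ^ (θ - 1) * |w r| ^ p ≤
    1 / p * (∫ r in Ioi (0 : ℝ), r ^ (θ + β - 1) * |r ^ (1 - β) * k r| ^ p) +
      lam ^ p * (1 - 1 / p) * ∫ r in Ioi (0 : ℝ), r ^ (θ + β - 1) * |w r| ^ p := by
  have hp0 : 0 < p := by linarith
  set fA : ℝ → ℝ := fun r => r ^ (θ + β - 1) * |r ^ (1 - β) * k r| ^ p with hfA
  set fB : ℝ → ℝ := fun r => r ^ (θ + β - 1) * |w r| ^ p with hfB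
  set fD : ℝ → ℝ := fun r => r ^ (θ - 1) * |w r| ^ p with hfD
  set fP : ℝ → ℝ := fun r => r ^ (θ + β - 1) * |r ^ (1 - β) * k r + lam * w r| ^ p with hfP
  have h1p : 0 ≤ 1 - 1 / p := by
    rw [sub_nonneg, div_le_one hp0]; linarith
  have hA0 : ∀ r, 0 < r → 0 ≤ fA r := fun r hr => by positivity
  have hB0 : ∀ r, 0 < r → 0 ≤ fB r := fun r hr => by positivity
  have hD0 : ∀ r, 0 < r → 0 ≤ fD r := fun r hr => by positivity
  have hP0 : ∀ r, 0 < r → 0 ≤ fP r := fun r hr => by positivity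
  have hPi : IntegrableOn fP (Ioi 0) := by
    refine Integrable.mono' (g := fun r => 2 ^ (p - 1) * (fA r + lam ^ p * fB r))
      ((hA.add (hB.const_mul (lam ^ p))).const_mul (2 ^ (p - 1))) ?_ ?_
    · refine ((continuousOn_rpow_Ioi _).aestronglyMeasurable measurableSet_Ioi).mul ?_
      refine ((((((continuousOn_rpow_Ioi (1 - β)).aestronglyMeasurable measurableSet_Ioi).mul
        h.aestronglyMeasurable).add ((h.continuousOn.aestronglyMeasurable
        measurableSet_Ioi).const_mul lam)).norm).aemeasurable.pow_const p).aestronglyMeasurable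
    · filter_upwards [ae_restrict_mem measurableSet_Ioi] with r hr
      rw [Real.norm_of_nonneg (hP0 r hr)]
      have h1 := abs_add_rpow_le (p := p) (by linarith) (r ^ (1 - β) * k r) (lam * w r)
      rw [abs_mul lam, abs_of_pos hlam, Real.mul_rpow hlam.le (abs_nonneg _)] at h1
      have hr' : (0 : ℝ) < r := hr
      have h2 := mul_le_mul_of_nonneg_left h1 (by positivity : 0 ≤ r ^ (θ + β - 1))
      calc fP r ≤ _ := h2
        _ = _ := by simp only [hfA, hfB]; ring
  have hDi : ∀ a b, 0 < a → 0 < b → IntervalIntegrable fD volume a b := fun a b ha hb =>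
    ((h.continuousOn_rpow_mul hp0.le _).mono (uIcc_subset_Ioi ha hb)).intervalIntegrable
  set c : ℝ := 2 ^ (1 - p) / p with hc
  have hc0 : 0 < c := by positivity
  set e : ℝ := lam ^ (p - 1) * (θ / p) with he
  have he0 : 0 < e := by positivity
  set F : ℝ → ℝ := fun r => c * fP r + e * fD r with hF
  have hFi : ∀ a b, 0 < a → 0 < b → IntervalIntegrable F volume a b := fun a b ha hb =>
    ((hPi.intervalIntegrable_of_pos ha hb).const_mul c).add ((hDi a b ha hb).const_mul e)
  have hF0 : ∀ r, 0 < r → 0 ≤ F r := fun r hr =>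
    add_nonneg (mul_nonneg hc0.le (hP0 r hr)) (mul_nonneg he0.le (hD0 r hr))
  set R : ℝ := 1 / p * (∫ r in Ioi (0 : ℝ), fA r) + lam ^ p * (1 - 1 / p) *
    ∫ r in Ioi (0 : ℝ), fB r with hR
  have hH : ∀ x : ℝ, 0 < x → HasDerivAt (fun r : ℝ => r ^ θ) (θ * x ^ (θ - 1)) x := fun x hx =>
    Real.hasDerivAt_rpow_const (Or.inl hx.ne')
  have hH' : ContinuousOn (fun x : ℝ => θ * x ^ (θ - 1)) (Ioi 0) :=
    continuousOn_const.mul (continuousOn_rpow_Ioi _)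
  -- The slack `η` absorbs the boundary term at the upper endpoint; the one at the lower endpoint
  -- has a favourable sign and is dropped.
  have key : ∀ η, 0 < η → IntegrableOn F (Ioi 0) ∧ ∫ r in Ioi (0 : ℝ), F r ≤ R + η := by
    intro η hη
    refine integrableOn_Ioi_zero_of_bound hF0 hFi fun ε T hε hεT => ?_
    obtain ⟨T', hT', hs⟩ := exists_ge_rpow_mul_le (η := η * (p / lam ^ (p - 1))) hβ hB
      (by positivity) (hε.trans_le hεT)
    refine ⟨ε, T', hε, le_rfl, hT', ?_⟩
    have hT0 : 0 < T' := hε.trans_le (hεT.trans hT')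
    obtain ⟨hGi, hG⟩ := h.integral_weight_mul_abs_rpow hp hH hH' hε hT0
    have hAi := (hA.intervalIntegrable_of_pos hε hT0).const_mul (1 / p)
    have hBi := (hB.intervalIntegrable_of_pos hε hT0).const_mul (lam ^ p * (1 - 1 / p))
    have hGi' := hGi.const_mul (lam ^ (p - 1) / p)
    have hmono := intervalIntegral.integral_mono_on (hεT.trans hT') (hFi ε T' hε hT0)
      ((hAi.add hBi).add hGi') fun r hr =>
        deficit_pointwise (θ := θ) (β := β) hp hlam (hε.trans_le hr.1) (w r) (k r)
    refine hmono.trans ?_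
    rw [intervalIntegral.integral_add (hAi.add hBi) hGi', intervalIntegral.integral_add hAi hBi,
      intervalIntegral.integral_const_mul, intervalIntegral.integral_const_mul,
      intervalIntegral.integral_const_mul, hG]
    have e1 := intervalIntegral_le_integral_Ioi hA0 hA hε (hεT.trans hT')
    have e2 := intervalIntegral_le_integral_Ioi hB0 hB hε (hεT.trans hT')
    have e3 : lam ^ (p - 1) / p * (T' ^ θ * |w T'| ^ p - ε ^ θ * |w ε| ^ p) ≤ η := by
      have : 0 ≤ ε ^ θ * |w ε| ^ p := by positivity
      calc lam ^ (p - 1) / p * (T' ^ θ * |w T'| ^ p - ε ^ θ * |w ε| ^ p)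
          ≤ lam ^ (p - 1) / p * (η * (p / lam ^ (p - 1))) := by gcongr; linarith
        _ = η := by field_simp
    have e4 := mul_le_mul_of_nonneg_left e1 (by positivity : 0 ≤ 1 / p)
    have e5 := mul_le_mul_of_nonneg_left e2 (by positivity : 0 ≤ lam ^ p * (1 - 1 / p))
    simp only [hfA, hfB] at e4 e5 hR ⊢
    linarith
  have hFI := (key 1 one_pos).1
  have hFle : ∫ r in Ioi (0 : ℝ), F r ≤ R := le_of_forall_pos_le_add fun η hη => (key η hη).2
  have hDI : IntegrableOn fD (Ioi 0) := by
    have : IntegrableOn (fun r => e⁻¹ * (F r - c * fP r)) (Ioi 0) :=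
      (hFI.sub (hPi.const_mul c)).const_mul e⁻¹
    refine this.congr (.of_forall fun r => ?_)
    simp only [hF]; field_simp; ring
  refine ⟨hDI, hPi, ?_⟩
  rw [hF, integral_add (hPi.const_mul c) (hDI.const_mul e), integral_const_mul,
    integral_const_mul] at hFle
  exact hFle

end

/-! ### A weighted Poincaré inequality and stability on the half-line -/

section

variable {p θ β : ℝ}

theorem rpow_sub_one_mul_rpow {r : ℝ} (hr : 0 < r) (θ β : ℝ) :
    r ^ (θ + β - 1) = r ^ (θ - 1) * r ^ β := by
  rw [← Real.rpow_add hr]; ring_nf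

theorem rpow_add_sub_one_mul_rpow {r : ℝ} (hr : 0 < r) (θ β : ℝ) :
    r ^ θ = r ^ (θ + β - 1) * r ^ (1 - β) := by
  rw [← Real.rpow_add hr]; ring_nf

/-- For `r^β ≤ m/λ`. Put `ρ = r^(1-β) k + λ z`. The integrating factor `E = exp(pλ r^β/β)` removes
the term of the wrong sign: if `k = z'`, the derivative of `r^θ E |z|^p` is `E (θ r^(θ-1) |z|^p + p
r^(θ+β-1) |z|^(p-2) z ρ)`. In this range `1 ≤ E ≤ exp(pm/β)`, so the factor costs only a constant.
-/
theorem poincare_pointwise_inner (hp : 2 ≤ p) (hθ : 0 < θ) (hβ : 0 < β) {m lam r : ℝ} (hm : 0 < m)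
    (hlam : 0 < lam) (hr : 0 < r) (hrm : r ^ β ≤ m / lam) (z k : ℝ) :
    θ / 2 * (r ^ (θ - 1) * |z| ^ p) ≤
      Real.exp (p * m / β) * (p * (θ / (2 * p)) ^ (1 - p) * m ^ (p - 1)) * lam ^ (1 - p) *
        (r ^ (θ + β - 1) * |r ^ (1 - β) * k + lam * z| ^ p) +
      ((θ * r ^ (θ - 1) * Real.exp (p * lam * r ^ β / β) +
          r ^ θ * (Real.exp (p * lam * r ^ β / β) * (p * lam * r ^ (β - 1)))) * |z| ^ p +
        r ^ θ * Real.exp (p * lam * r ^ β / β) * (p * (|z| ^ (p - 2) * z * k))) := by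
  have hp0 : 0 < p := by linarith
  set ρ := r ^ (1 - β) * k + lam * z with hρ
  set E := Real.exp (p * lam * r ^ β / β) with hE
  have hE1 : 1 ≤ E := Real.one_le_exp (by positivity)
  have hE2 : E ≤ Real.exp (p * m / β) := by
    refine Real.exp_le_exp.2 ?_
    gcongr ?_ / _
    rw [le_div_iff₀ hlam] at hrm
    nlinarith
  have hint : ((θ * r ^ (θ - 1) * E + r ^ θ * (E * (p * lam * r ^ (β - 1)))) * |z| ^ p +
      r ^ θ * E * (p * (|z| ^ (p - 2) * z * k))) =
      E * (θ * (r ^ (θ - 1) * |z| ^ p) + p * (r ^ (θ + β - 1) * (|z| ^ (p - 2) * z * ρ))) := by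
    have h1 : r ^ (1 - β) * r ^ (β - 1) = 1 := by
      rw [← Real.rpow_add hr]; simp
    have h2 := abs_rpow_sub_two_mul_self_mul_self hp z
    rw [rpow_add_sub_one_mul_rpow hr θ β, hρ, ← h2]
    linear_combination (r ^ (θ + β - 1) * E * p * lam * |z| ^ (p - 2) * z * z) * h1
  rw [hint]
  -- With this `ε` the cross term consumes exactly half of `θ r^(θ-1) |z|^p`.
  set ε := θ / (2 * p) with hε
  have hε0 : 0 < ε := by positivity
  have h3 := abs_rpow_sub_two_mul_self_mul_le p (-ρ) z
  have h4 := rpow_sub_one_mul_le hp hε0 (abs_nonneg z) (by positivity : 0 ≤ r ^ β * |ρ|)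
  -- One factor `r^β` is kept to build the weight `r^(θ+β-1)`; the other `p - 1` are bounded by
  -- `m/λ`, which produces the scaling `λ^(1-p)`.
  have h5 : (r ^ β * |ρ|) ^ p ≤ r ^ β * (m ^ (p - 1) * lam ^ (1 - p)) * |ρ| ^ p := by
    rw [Real.mul_rpow (by positivity) (abs_nonneg _)]
    gcongr
    have : (r ^ β) ^ p = r ^ β * (r ^ β) ^ (p - 1) := by
      rw [← Real.rpow_one_add' (by positivity) (by linarith)]; ring_nf
    rw [this]
    gcongr
    calc (r ^ β) ^ (p - 1) ≤ (m / lam) ^ (p - 1) :=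
          Real.rpow_le_rpow (by positivity) hrm (by linarith)
      _ = m ^ (p - 1) * lam ^ (1 - p) := by
        rw [Real.div_rpow hm.le hlam.le, div_eq_mul_inv, ← Real.rpow_neg hlam.le, neg_sub]
  rw [abs_neg] at h3
  set X := r ^ (θ - 1) * |z| ^ p with hX
  set Y := r ^ (θ + β - 1) * |ρ| ^ p with hY
  have hX0 : 0 ≤ X := by positivity
  have hY0 : 0 ≤ Y := by positivity
  set C := p * ε ^ (1 - p) * m ^ (p - 1) with hC
  have hC0 : 0 ≤ C := by positivity
  have h6 : -(p * (r ^ (θ + β - 1) * (|z| ^ (p - 2) * z * ρ))) ≤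
      θ / 2 * X + C * lam ^ (1 - p) * Y := by
    have hM := rpow_sub_one_mul_rpow hr θ β
    calc -(p * (r ^ (θ + β - 1) * (|z| ^ (p - 2) * z * ρ)))
        = p * (r ^ (θ + β - 1) * (|z| ^ (p - 2) * z * (-ρ))) := by ring
      _ ≤ p * (r ^ (θ + β - 1) * (|z| ^ (p - 1) * |ρ|)) := by gcongr
      _ = p * r ^ (θ - 1) * (|z| ^ (p - 1) * (r ^ β * |ρ|)) := by rw [hM]; ring
      _ ≤ p * r ^ (θ - 1) * (ε * |z| ^ p + ε ^ (1 - p) *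
          (r ^ β * (m ^ (p - 1) * lam ^ (1 - p)) * |ρ| ^ p)) := by
        gcongr; exact h4.trans (by gcongr)
      _ = θ / 2 * X + C * lam ^ (1 - p) * Y := by
        have : p * ε = θ / 2 := by rw [hε]; field_simp
        rw [hX, hY, hC, hM, ← this]; ring
  have hl : 0 ≤ C * lam ^ (1 - p) * Y := by positivity
  have h7 : 0 ≤ (E - 1) * (θ / 2 * X) := mul_nonneg (by linarith) (by positivity)
  have h8 : 0 ≤ (Real.exp (p * m / β) - E) * (C * lam ^ (1 - p) * Y) :=
    mul_nonneg (by linarith) hl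
  have h9 := mul_le_mul_of_nonneg_left h6 (by linarith : 0 ≤ E)
  linarith

/-- Far out no integrating factor is needed. With `ρ = r^(1-β) k + λ z` and `k = z'`, the derivative
of `r^θ |z|^p` contains the damping term `-pλ r^(θ+β-1) |z|^p`, at least `4θ r^(θ-1) |z|^p` in size.
Young's inequality with `ε = λ/4` spends a quarter of it on the cross term, and the remaining `3θ`
beats the growth `θ` by `2θ`. -/
theorem poincare_pointwise_outer (hp : 2 ≤ p) {lam r : ℝ}
    (hlam : 0 < lam) (hr : 0 < r) (hrm : 4 * θ / p / lam ≤ r ^ β) (z k : ℝ) :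
    2 * θ * (r ^ (θ - 1) * |z| ^ p) ≤
      p * 4 ^ (p - 1) * lam ^ (1 - p) *
        (r ^ (θ + β - 1) * |r ^ (1 - β) * k + lam * z| ^ p) -
      (θ * r ^ (θ - 1) * |z| ^ p + r ^ θ * (p * (|z| ^ (p - 2) * z * k))) := by
  have hp0 : 0 < p := by linarith
  set ρ := r ^ (1 - β) * k + lam * z with hρ
  have hint : θ * r ^ (θ - 1) * |z| ^ p + r ^ θ * (p * (|z| ^ (p - 2) * z * k)) =
      θ * (r ^ (θ - 1) * |z| ^ p) + p * (r ^ (θ + β - 1) * (|z| ^ (p - 2) * z * ρ)) -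
        p * lam * (r ^ (θ + β - 1) * |z| ^ p) := by
    have h2 := abs_rpow_sub_two_mul_self_mul_self hp z
    rw [rpow_add_sub_one_mul_rpow hr θ β, hρ, ← h2]
    ring
  rw [hint]
  have h3 := abs_rpow_sub_two_mul_self_mul_le p ρ z
  have h4 := rpow_sub_one_mul_le hp (by positivity : 0 < lam / 4) (abs_nonneg z) (abs_nonneg ρ)
  have h5 : (lam / 4) ^ (1 - p) = 4 ^ (p - 1) * lam ^ (1 - p) := by
    rw [Real.div_rpow hlam.le (by norm_num), div_eq_mul_inv, ← Real.rpow_neg (by norm_num), neg_sub]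
    ring
  rw [h5] at h4
  set M := r ^ (θ + β - 1) with hMdef
  have hM0 : 0 ≤ M := by positivity
  have h6 := mul_le_mul_of_nonneg_left (h3.trans h4) (by positivity : 0 ≤ p * M)
  have h7 : 4 * θ * (r ^ (θ - 1) * |z| ^ p) ≤ p * lam * (M * |z| ^ p) := by
    rw [hMdef, rpow_sub_one_mul_rpow hr θ β]
    rw [div_div, div_le_iff₀ (by positivity)] at hrm
    have : 0 ≤ r ^ (θ - 1) * |z| ^ p := by positivity
    nlinarith [mul_le_mul_of_nonneg_left hrm this]
  linarith

/-- The zero of `z` sits at the radius where the inner and outer estimates meet, so that integrating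
either one gives no boundary term there. The boundary terms at the far ends have the right sign. The
constant is the sum of the two contributions and does not depend on `λ` beyond the explicit power.
-/
theorem exists_poincare (hp : 2 ≤ p) (hθ : 0 < θ) (hβ : 0 < β) :
    ∃ C, 0 < C ∧ ∀ (z k : ℝ → ℝ) (lam : ℝ), 0 < lam → IsPrimitive z k →
      z ((4 * θ / p / lam) ^ β⁻¹) = 0 →
      IntegrableOn (fun r : ℝ => r ^ (θ + β - 1) * |r ^ (1 - β) * k r + lam * z r| ^ p) (Ioi 0) →
      IntegrableOn (fun r : ℝ => r ^ (θ - 1) * |z r| ^ p) (Ioi 0) ∧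
      ∫ r in Ioi (0 : ℝ), r ^ (θ - 1) * |z r| ^ p ≤ C * lam ^ (1 - p) *
        ∫ r in Ioi (0 : ℝ), r ^ (θ + β - 1) * |r ^ (1 - β) * k r + lam * z r| ^ p := by
  have hp0 : 0 < p := by linarith
  set m := 4 * θ / p with hm
  have hm0 : 0 < m := by positivity
  set K₁ := Real.exp (p * m / β) * (p * (θ / (2 * p)) ^ (1 - p) * m ^ (p - 1)) with hK₁
  set K₂ := p * 4 ^ (p - 1) with hK₂
  have hK₁0 : 0 < K₁ := by positivity
  have hK₂0 : 0 < K₂ := by positivity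
  refine ⟨2 / θ * K₁ + K₂ / (2 * θ), by positivity, fun z k lam hlam h hz hPi => ?_⟩
  set r₀ := (m / lam) ^ β⁻¹ with hr₀
  have hr₀0 : 0 < r₀ := by positivity
  have hr₀β : r₀ ^ β = m / lam := by
    rw [hr₀, ← Real.rpow_mul (by positivity), inv_mul_cancel₀ hβ.ne', Real.rpow_one]
  set fD : ℝ → ℝ := fun r => r ^ (θ - 1) * |z r| ^ p with hfD
  set fP : ℝ → ℝ := fun r => r ^ (θ + β - 1) * |r ^ (1 - β) * k r + lam * z r| ^ p with hfP
  set J := ∫ r in Ioi (0 : ℝ), fP r with hJ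
  have hD0 : ∀ r, 0 < r → 0 ≤ fD r := fun r hr => by positivity
  have hP0 : ∀ r, 0 < r → 0 ≤ fP r := fun r hr => by positivity
  have hDi : ∀ a b, 0 < a → 0 < b → IntervalIntegrable fD volume a b := fun a b ha hb =>
    ((h.continuousOn_rpow_mul hp0.le _).mono (uIcc_subset_Ioi ha hb)).intervalIntegrable
  have hl0 : 0 < lam ^ (1 - p) := by positivity
  have hpow : ∀ q x : ℝ, 0 < x → HasDerivAt (fun r : ℝ => r ^ q) (q * x ^ (q - 1)) x :=
    fun q x hx => Real.hasDerivAt_rpow_const (Or.inl hx.ne')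
  have hinner : ∀ ε, 0 < ε → ε ≤ r₀ → ∫ r in ε..r₀, fD r ≤ 2 / θ * K₁ * lam ^ (1 - p) * J := by
    intro ε hε hεr
    have hexp : ∀ x : ℝ, 0 < x → HasDerivAt (fun r : ℝ => Real.exp (p * lam * r ^ β / β))
        (Real.exp (p * lam * x ^ β / β) * (p * lam * x ^ (β - 1))) x := by
      intro x hx
      have := (((hpow β x hx).const_mul (p * lam)).div_const β).exp
      convert this using 1
      field_simp
    have hec : ContinuousOn (fun r : ℝ => Real.exp (p * lam * r ^ β / β)) (Ioi 0) :=
      fun x hx => (hexp x hx).continuousAt.continuousWithinAt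
    obtain ⟨hGi, hG⟩ := h.integral_weight_mul_abs_rpow hp
      (fun x hx => (hpow θ x hx).mul (hexp x hx))
      (((continuousOn_const.mul (continuousOn_rpow_Ioi _)).mul hec).add
        ((continuousOn_rpow_Ioi _).mul (hec.mul (continuousOn_const.mul
          (continuousOn_rpow_Ioi _))))) hε hr₀0
    have hPi' := (hPi.intervalIntegrable_of_pos hε hr₀0).const_mul (K₁ * lam ^ (1 - p))
    have hmono := intervalIntegral.integral_mono_on hεr ((hDi ε r₀ hε hr₀0).const_mul (θ / 2))
      (hPi'.add hGi) fun r hr => poincare_pointwise_inner hp hθ hβ hm0 hlam (hε.trans_le hr.1)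
        (hr₀β ▸ Real.rpow_le_rpow (hε.le.trans hr.1) hr.2 hβ.le) (z r) (k r)
    rw [intervalIntegral.integral_add hPi' hGi, intervalIntegral.integral_const_mul,
      intervalIntegral.integral_const_mul, hG, hz, abs_zero, Real.zero_rpow hp0.ne', mul_zero,
      zero_sub] at hmono
    have e1 : 0 ≤ ((fun r : ℝ => r ^ θ) * fun r => Real.exp (p * lam * r ^ β / β)) ε * |z ε| ^ p := by
      simp only [Pi.mul_apply]; positivity
    have e2 := mul_le_mul_of_nonneg_left (intervalIntegral_le_integral_Ioi hP0 hPi hε hεr)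
      (by positivity : 0 ≤ K₁ * lam ^ (1 - p))
    have e3 : θ / 2 * ∫ r in ε..r₀, fD r ≤ K₁ * lam ^ (1 - p) * J := by
      simp only [hfP] at e2 hJ ⊢; linarith
    calc ∫ r in ε..r₀, fD r = 2 / θ * (θ / 2 * ∫ r in ε..r₀, fD r) := by field_simp
      _ ≤ 2 / θ * (K₁ * lam ^ (1 - p) * J) := by gcongr
      _ = _ := by ring
  have houter : ∀ T, r₀ ≤ T → ∫ r in r₀..T, fD r ≤ K₂ / (2 * θ) * lam ^ (1 - p) * J := by
    intro T hT
    have hT0 := hr₀0.trans_le hT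
    obtain ⟨hGi, hG⟩ := h.integral_weight_mul_abs_rpow hp (hpow θ)
      (continuousOn_const.mul (continuousOn_rpow_Ioi _)) hr₀0 hT0
    have hPi' := (hPi.intervalIntegrable_of_pos hr₀0 hT0).const_mul (K₂ * lam ^ (1 - p))
    have hmono := intervalIntegral.integral_mono_on hT ((hDi r₀ T hr₀0 hT0).const_mul (2 * θ))
      (hPi'.sub hGi) fun r hr => poincare_pointwise_outer (β := β) hp hlam
        (hr₀0.trans_le hr.1) (hr₀β ▸ Real.rpow_le_rpow hr₀0.le hr.1 hβ.le) (z r) (k r)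
    rw [intervalIntegral.integral_sub hPi' hGi, intervalIntegral.integral_const_mul,
      intervalIntegral.integral_const_mul, hG, hz, abs_zero, Real.zero_rpow hp0.ne', mul_zero,
      sub_zero] at hmono
    have e1 : 0 ≤ T ^ θ * |z T| ^ p := by positivity
    have e2 := mul_le_mul_of_nonneg_left (intervalIntegral_le_integral_Ioi hP0 hPi hr₀0 hT)
      (by positivity : 0 ≤ K₂ * lam ^ (1 - p))
    have e3 : 2 * θ * ∫ r in r₀..T, fD r ≤ K₂ * lam ^ (1 - p) * J := by
      simp only [hfP] at e2 hJ ⊢; linarith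
    calc ∫ r in r₀..T, fD r = 1 / (2 * θ) * (2 * θ * ∫ r in r₀..T, fD r) := by field_simp
      _ ≤ 1 / (2 * θ) * (K₂ * lam ^ (1 - p) * J) := by gcongr
      _ = _ := by ring
  refine integrableOn_Ioi_zero_of_bound hD0 hDi fun ε T hε hεT => ?_
  have h1 : 0 < min ε r₀ := lt_min hε hr₀0
  have h2 : 0 < max T r₀ := lt_max_of_lt_right hr₀0
  -- The interval is enlarged to contain `r₀`, where it is cut in two.
  refine ⟨min ε r₀, max T r₀, h1, min_le_left _ _, le_max_left _ _, ?_⟩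
  rw [← intervalIntegral.integral_add_adjacent_intervals (hDi _ _ h1 hr₀0) (hDi _ _ hr₀0 h2)]
  have := hinner _ h1 (min_le_right _ _)
  have := houter _ (le_max_right T r₀)
  linarith

/-- The stability inequality for functions on the half-line. -/
theorem exists_stability_half_line (hp : 2 ≤ p) (hθ : 0 < θ) (hβ : 0 < β) :
    ∃ C, 0 < C ∧ ∀ w k : ℝ → ℝ, IsPrimitive w k →
      IntegrableOn (fun r : ℝ => r ^ (θ + β - 1) * |r ^ (1 - β) * k r| ^ p) (Ioi 0) →
      IntegrableOn (fun r : ℝ => r ^ (θ + β - 1) * |w r| ^ p) (Ioi 0) →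
      IntegrableOn (fun r : ℝ => r ^ (θ - 1) * |w r| ^ p) (Ioi 0) ∧
      ∃ Λ lam : ℝ, 0 < lam ∧
        IntegrableOn (fun r : ℝ => r ^ (θ - 1) * |w r - Λ * Real.exp (-(lam * r ^ β) / β)| ^ p)
          (Ioi 0) ∧
        θ / p * (∫ r in Ioi (0 : ℝ), r ^ (θ - 1) * |w r| ^ p) + C * (∫ r in Ioi (0 : ℝ),
            r ^ (θ - 1) * |w r - Λ * Real.exp (-(lam * r ^ β) / β)| ^ p) ≤
          (∫ r in Ioi (0 : ℝ), r ^ (θ + β - 1) * |r ^ (1 - β) * k r| ^ p) ^ (1 / p) *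
          (∫ r in Ioi (0 : ℝ), r ^ (θ + β - 1) * |w r| ^ p) ^ (1 - 1 / p) := by
  have hp0 : 0 < p := by linarith
  obtain ⟨C₀, hC₀, H⟩ := exists_poincare hp hθ hβ
  set c : ℝ := 2 ^ (1 - p) / p with hc
  have hc0 : 0 < c := by positivity
  refine ⟨c / C₀, by positivity, fun w k h hA hB => ?_⟩
  have hdef := fun lam (hlam : (0 : ℝ) < lam) => deficit hp hθ hβ h hA hB hlam
  have hDI := (hdef 1 one_pos).1
  refine ⟨hDI, ?_⟩
  set A := ∫ r in Ioi (0 : ℝ), r ^ (θ + β - 1) * |r ^ (1 - β) * k r| ^ p with hAdef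
  set B := ∫ r in Ioi (0 : ℝ), r ^ (θ + β - 1) * |w r| ^ p with hBdef
  set D := ∫ r in Ioi (0 : ℝ), r ^ (θ - 1) * |w r| ^ p with hDdef
  have nonneg : ∀ (q : ℝ) (g : ℝ → ℝ), 0 ≤ ∫ r in Ioi (0 : ℝ), r ^ q * |g r| ^ p := fun q g =>
    setIntegral_nonneg measurableSet_Ioi fun r hr => by
      have : (0 : ℝ) < r := hr
      positivity
  have hA0 : 0 ≤ A := nonneg _ _
  have hB0 : 0 ≤ B := nonneg _ _
  have hD0 : 0 ≤ D := nonneg _ _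
  have h1p : 0 ≤ 1 - 1 / p := by
    rw [sub_nonneg, div_le_one hp0]; linarith
  have hmain : ∀ lam, 0 < lam → lam ^ (p - 1) * (θ / p) * D ≤
      1 / p * A + lam ^ p * (1 - 1 / p) * B := fun lam hlam => by
    have := (hdef lam hlam).2.2
    have h2 : 0 ≤ c * ∫ r in Ioi (0 : ℝ), r ^ (θ + β - 1) * |r ^ (1 - β) * k r + lam * w r| ^ p :=
      mul_nonneg hc0.le (nonneg _ _)
    linarith
  -- If `A` or `B` vanishes there is no optimal `λ`, but a small `λ` (for `A = 0`) or a large one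
  -- (for `B = 0`) forces `D = 0`, and `Λ = 0` is then admissible.
  by_cases hdeg : A = 0 ∨ B = 0
  · have hD : D = 0 := by
      refine le_antisymm ?_ hD0
      refine le_of_forall_pos_le_add fun η hη => ?_
      rw [zero_add]
      rcases hdeg with h0 | h0
      · set lam := η * (θ / p) / (B + 1) with hlamdef
        have hlam : 0 < lam := by positivity
        have h1 := hmain lam hlam
        have h2 : lam ^ p = lam ^ (p - 1) * lam := by
          rw [← Real.rpow_add_one hlam.ne']; ring_nf
        have hl : 0 < lam ^ (p - 1) := by positivity
        rw [h0, mul_zero, zero_add, h2] at h1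
        have h3 : θ / p * D ≤ lam * (1 - 1 / p) * B :=
          le_of_mul_le_mul_left (by linarith) hl
        have h4 : lam * (1 - 1 / p) * B ≤ lam * (B + 1) := by
          have : (1 - 1 / p) * B ≤ 1 * B := by
            gcongr; simp; positivity
          rw [mul_assoc]
          gcongr
          linarith
        have h5 : lam * (B + 1) = θ / p * η := by rw [hlamdef]; field_simp
        exact le_of_mul_le_mul_left (by linarith) (by positivity : 0 < θ / p)
      · set s := (1 / p * A + 1) / (θ / p * η) with hs
        have hs0 : 0 < s := by positivity
        set lam := s ^ (p - 1)⁻¹ with hlamdef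
        have hlam : 0 < lam := by positivity
        have h1 := hmain lam hlam
        have hl : lam ^ (p - 1) = s := by
          rw [hlamdef, ← Real.rpow_mul hs0.le, inv_mul_cancel₀ (by linarith), Real.rpow_one]
        rw [h0, mul_zero, add_zero, hl] at h1
        have h5 : s * (θ / p) * η = 1 / p * A + 1 := by rw [hs]; field_simp
        exact le_of_mul_le_mul_left (by linarith) (by positivity : 0 < s * (θ / p))
    refine ⟨0, 1, one_pos, by simpa using hDI, ?_⟩
    simp only [zero_mul, sub_zero, ← hDdef, hD, mul_zero, add_zero]
    positivity
  · push Not at hdeg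
    have hA' : 0 < A := lt_of_le_of_ne hA0 (Ne.symm hdeg.1)
    have hB' : 0 < B := lt_of_le_of_ne hB0 (Ne.symm hdeg.2)
    -- The minimiser of `λ^(1-p) (A/p + λ^p (1-1/p) B)`; at this value the bracket equals `A`.
    set lam := (A / B) ^ (1 / p) with hlamdef
    have hlam : 0 < lam := by positivity
    have hlp : lam ^ p = A / B := by
      rw [hlamdef, ← Real.rpow_mul (by positivity), one_div_mul_cancel hp0.ne', Real.rpow_one]
    set r₀ := (4 * θ / p / lam) ^ β⁻¹ with hr₀
    -- Chosen so that `v r₀ = w r₀`.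
    set Λ := w r₀ * Real.exp (lam * r₀ ^ β / β) with hΛ
    set v : ℝ → ℝ := fun r => Λ * Real.exp (-(lam * r ^ β) / β) with hv
    set kv : ℝ → ℝ := fun r => -(lam * r ^ (β - 1)) * v r with hkv
    have hvd : ∀ x, 0 < x → HasDerivAt v (kv x) x := by
      intro x hx
      have := (((((Real.hasDerivAt_rpow_const (p := β) (Or.inl hx.ne')).const_mul
        lam).neg).div_const β).exp).const_mul Λ
      refine this.congr_deriv ?_
      change Λ * (Real.exp (-(lam * x ^ β) / β) * (-(lam * (β * x ^ (β - 1))) / β)) =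
        -(lam * x ^ (β - 1)) * (Λ * Real.exp (-(lam * x ^ β) / β))
      field_simp
    have hvp : IsPrimitive v kv := IsPrimitive.of_hasDerivAt hvd
      (((continuousOn_rpow_Ioi _).const_mul lam).neg.mul
        fun x hx => (hvd x hx).continuousAt.continuousWithinAt)
    have hz0 : w r₀ - v r₀ = 0 := by
      simp only [hv, hΛ]
      rw [mul_assoc, ← Real.exp_add]
      have : lam * r₀ ^ β / β + -(lam * r₀ ^ β) / β = 0 := by ring
      rw [this]; simp
    -- Since `r^(1-β) v' + λ v = 0`, subtracting `v` does not change the remainder.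
    have hρ : EqOn (fun r : ℝ => r ^ (θ + β - 1) * |r ^ (1 - β) * k r + lam * w r| ^ p)
        (fun r : ℝ => r ^ (θ + β - 1) * |r ^ (1 - β) * (k r - kv r) + lam * (w r - v r)| ^ p)
        (Ioi 0) := by
      intro r hr
      have h1 : r ^ (1 - β) * r ^ (β - 1) = 1 := by
        rw [← Real.rpow_add hr]; simp
      have h2 : r ^ (1 - β) * (k r - kv r) + lam * (w r - v r) = r ^ (1 - β) * k r + lam * w r := by
        simp only [hkv]
        linear_combination lam * v r * h1
      simp only [h2]
    obtain ⟨-, hPi, hle⟩ := hdef lam hlam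
    obtain ⟨hI, hIle⟩ := H _ _ lam hlam (h.sub hvp) hz0 (hPi.congr_fun hρ measurableSet_Ioi)
    refine ⟨Λ, lam, hlam, hI, ?_⟩
    rw [← setIntegral_congr_fun measurableSet_Ioi hρ] at hIle
    set J := ∫ r in Ioi (0 : ℝ), r ^ (θ + β - 1) * |r ^ (1 - β) * k r + lam * w r| ^ p with hJ
    set I := ∫ r in Ioi (0 : ℝ), r ^ (θ - 1) * |w r - v r| ^ p with hIdef
    have hl : 0 < lam ^ (p - 1) := by positivity
    have h1 : lam ^ (p - 1) * (c / C₀ * I) ≤ c * J := by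
      have h2 : lam ^ (p - 1) * lam ^ (1 - p) = 1 := by
        rw [← Real.rpow_add hlam]; simp
      calc lam ^ (p - 1) * (c / C₀ * I)
          ≤ lam ^ (p - 1) * (c / C₀ * (C₀ * lam ^ (1 - p) * J)) := by gcongr
        _ = (lam ^ (p - 1) * lam ^ (1 - p)) * (c / C₀ * C₀ * J) := by ring
        _ = c * J := by rw [h2, div_mul_cancel₀ _ hC₀.ne', one_mul]
    have h3 : 1 / p * A + lam ^ p * (1 - 1 / p) * B = A := by
      rw [hlp]; field_simp; ring
    have h4 : A = lam ^ (p - 1) * (A ^ (1 / p) * B ^ (1 - 1 / p)) := by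
      have e1 : lam ^ (p - 1) = (A / B) ^ (1 - 1 / p) := by
        rw [hlamdef, ← Real.rpow_mul (by positivity)]
        congr 1; field_simp
      rw [e1, Real.div_rpow hA0 hB0]
      have e2 : A ^ (1 - 1 / p) * A ^ (1 / p) = A := by
        rw [← Real.rpow_add hA']; simp
      have e3 : 0 < B ^ (1 - 1 / p) := by positivity
      generalize B ^ (1 - 1 / p) = b at *
      generalize A ^ (1 - 1 / p) = a at *
      generalize A ^ (1 / p) = a' at *
      rw [← e2]
      field_simp
    refine le_of_mul_le_mul_left ?_ hl
    rw [← h4]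
    linarith

end

/-! ### Test functions on the half-line and the lemma of du Bois-Reymond -/

/-- `ψ` belongs to `C_c^∞((0, ∞))`. -/
structure IsTestHalfLine (ψ : ℝ → ℝ) : Prop where
  contDiff : ContDiff ℝ ∞ ψ
  hasCompactSupport : HasCompactSupport ψ
  tsupport_subset : tsupport ψ ⊆ Ioi 0

namespace IsTestHalfLine

variable {ψ : ℝ → ℝ}

theorem exists_Ioo (h : IsTestHalfLine ψ) : ∃ a b, 0 < a ∧ a < b ∧ tsupport ψ ⊆ Ioo a b := by
  have hK : IsCompact (tsupport ψ) := h.hasCompactSupport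
  rcases (tsupport ψ).eq_empty_or_nonempty with he | hne
  · exact ⟨1, 2, one_pos, by norm_num, by simp [he]⟩
  · obtain ⟨x, hx, hxl⟩ := hK.exists_isLeast hne
    obtain ⟨y, hy, hyl⟩ := hK.exists_isGreatest hne
    have hx0 : 0 < x := h.tsupport_subset hx
    refine ⟨x / 2, y + 1, by linarith, by linarith [hyl hx], fun z hz => ⟨?_, ?_⟩⟩
    · linarith [hxl hz]
    · linarith [hyl hz]

theorem eventually_eq_zero (h : IsTestHalfLine ψ) {x : ℝ} (hx : x ≤ 0) : ψ =ᶠ[𝓝 x] 0 :=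
  notMem_tsupport_iff_eventuallyEq.1 fun hx' => hx.not_gt (h.tsupport_subset hx')

theorem eq_zero (h : IsTestHalfLine ψ) {x : ℝ} (hx : x ≤ 0) : ψ x = 0 :=
  (h.eventually_eq_zero hx).eq_of_nhds

theorem of_contDiffOn {g : ℝ → ℝ} (h : IsTestHalfLine ψ) (hg : ContDiffOn ℝ ∞ g (Ioi 0)) :
    IsTestHalfLine (fun x => g x * ψ x) where
  contDiff := contDiff_iff_contDiffAt.2 fun x => by
    rcases le_or_gt x 0 with hx | hx
    · refine contDiffAt_const (c := (0 : ℝ)) |>.congr_of_eventuallyEq ?_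
      filter_upwards [h.eventually_eq_zero hx] with y hy
      simp [hy]
    · exact (hg.contDiffAt (Ioi_mem_nhds hx)).mul h.contDiff.contDiffAt
  hasCompactSupport := h.hasCompactSupport.mul_left
  tsupport_subset := (tsupport_mul_subset_right).trans h.tsupport_subset

theorem isTestHalfLine_deriv (h : IsTestHalfLine ψ) : IsTestHalfLine (deriv ψ) where
  contDiff := (contDiff_infty_iff_deriv.1 h.contDiff).2
  hasCompactSupport := h.hasCompactSupport.deriv
  tsupport_subset := (closure_minimal support_deriv_subset isClosed_closure).trans
    h.tsupport_subset

theorem differentiableAt (h : IsTestHalfLine ψ) (x : ℝ) : DifferentiableAt ℝ ψ x :=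
  (h.contDiff.differentiable (by simp)) x

theorem integrableOn_mul {g : ℝ → ℝ} (h : IsTestHalfLine ψ) (hg : LocallyIntegrableOn g (Ioi 0)) :
    IntegrableOn (fun x => g x * ψ x) (Ioi 0) := by
  have h1 : IntegrableOn (fun x => g x * ψ x) (tsupport ψ) :=
    (hg.integrableOn_compact_subset h.tsupport_subset h.hasCompactSupport).mul_continuousOn
      h.contDiff.continuous.continuousOn h.hasCompactSupport
  have h2 : Integrable (fun x => g x * ψ x) := by
    rw [← integrableOn_iff_integrable_of_support_subset (s := tsupport ψ)]
    · exact h1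
    · exact fun x hx => subset_tsupport _ (right_ne_zero_of_mul hx)
  exact h2.integrableOn

end IsTestHalfLine

theorem setIntegral_mul_eq_of_tsupport_subset {ψ : ℝ → ℝ} {a b : ℝ} (ha : 0 < a) (hab : a < b)
    (hs : tsupport ψ ⊆ Ioo a b) (g : ℝ → ℝ) :
    ∫ x in Ioi 0, g x * ψ x = ∫ x in a..b, g x * ψ x := by
  rw [intervalIntegral.integral_of_le hab.le]
  refine setIntegral_eq_of_subset_of_forall_sdiff_eq_zero measurableSet_Ioi
    (fun x hx => ha.trans hx.1) fun x hx => ?_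
  have : x ∉ tsupport ψ := fun hx' => hx.2 (Ioo_subset_Ioc_self (hs hx'))
  rw [image_eq_zero_of_notMem_tsupport this, mul_zero]

theorem IsPrimitive.integral_mul_deriv {w k ψ : ℝ → ℝ} (h : IsPrimitive w k)
    (hψ : IsTestHalfLine ψ) :
    ∫ x in Ioi 0, w x * deriv ψ x = -∫ x in Ioi 0, k x * ψ x := by
  obtain ⟨a, b, ha, hab, hs⟩ := hψ.exists_Ioo
  have hb := ha.trans hab
  have hs' : tsupport (deriv ψ) ⊆ Ioo a b :=
    (closure_minimal support_deriv_subset isClosed_closure).trans hs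
  rw [setIntegral_mul_eq_of_tsupport_subset ha hab hs,
    setIntegral_mul_eq_of_tsupport_subset ha hab hs',
    (h.absolutelyContinuousOnInterval ha hb).integral_mul_deriv_eq_deriv_mul
      (hψ.contDiff.contDiffOn.of_le (by simp)).absolutelyContinuousOnInterval]
  have hza : ψ a = 0 := image_eq_zero_of_notMem_tsupport fun hx => (hs hx).1.false
  have hzb : ψ b = 0 := image_eq_zero_of_notMem_tsupport fun hx => (hs hx).2.false
  rw [hza, hzb, mul_zero, mul_zero, sub_zero, zero_sub]
  congr 1
  refine intervalIntegral.integral_congr_ae ?_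
  filter_upwards [h.ae_hasDerivAt ha hb] with x hx hxab
  rw [(hx (uIoc_subset_uIcc hxab)).deriv]

/-- The primitive of a locally integrable function on `(0, ∞)`. -/
theorem isPrimitive_intervalIntegral {k : ℝ → ℝ} (hk : LocallyIntegrableOn k (Ioi 0)) (c : ℝ) :
    IsPrimitive (fun x => c + ∫ t in 1..x, k t) k := by
  have hi : ∀ a b, 0 < a → 0 < b → IntervalIntegrable k volume a b := fun a b ha hb =>
    intervalIntegrable_iff.2 ((hk.integrableOn_compact_subset (uIcc_subset_Ioi ha hb)
      isCompact_uIcc).mono_set uIoc_subset_uIcc)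
  refine ⟨hi, fun a b ha hb => ?_⟩
  rw [add_sub_add_left_eq_sub, intervalIntegral.integral_interval_sub_left (hi _ _ one_pos hb)
    (hi _ _ one_pos ha)]

theorem exists_isTestHalfLine_integral_eq_one : ∃ χ : ℝ → ℝ, IsTestHalfLine χ ∧ ∫ x, χ x = 1 := by
  let f : ContDiffBump (2 : ℝ) := ⟨1 / 2, 1, by norm_num, by norm_num⟩
  refine ⟨f.normed volume, ⟨f.contDiff_normed, f.hasCompactSupport_normed, ?_⟩, f.integral_normed⟩
  rw [f.tsupport_normed_eq]
  intro x hx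
  have : |x - 2| ≤ 1 := by simpa [Real.dist_eq] using hx
  have := (abs_le.1 this).1
  exact (by linarith : (0 : ℝ) < x)

theorem IsTestHalfLine.exists_deriv_eq {ζ : ℝ → ℝ} (h : IsTestHalfLine ζ) (h0 : ∫ x, ζ x = 0) :
    ∃ Z, IsTestHalfLine Z ∧ deriv Z = ζ := by
  obtain ⟨a, b, ha, hab, hs⟩ := h.exists_Ioo
  have hc := h.contDiff.continuous
  have hd : ∀ x, HasDerivAt (fun x => ∫ t in a..x, ζ t) (ζ x) x := fun x =>
    intervalIntegral.integral_hasDerivAt_right (hc.intervalIntegrable _ _)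
      hc.stronglyMeasurable.stronglyMeasurableAtFilter hc.continuousAt
  have hderiv : deriv (fun x => ∫ t in a..x, ζ t) = ζ := funext fun x => (hd x).deriv
  have hsupp : Function.support (fun x => ∫ t in a..x, ζ t) ⊆ Icc a b := by
    intro x hx
    by_contra hcon
    refine hx ?_
    rw [mem_Icc, not_and_or, not_le, not_le] at hcon
    rcases hcon with hx' | hx'
    · refine intervalIntegral.integral_zero_ae (.of_forall fun t ht => ?_)
      rw [uIoc_of_ge hx'.le] at ht
      exact image_eq_zero_of_notMem_tsupport fun h' => ((hs h').1.trans_le ht.2).false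
    · change ∫ t in a..x, ζ t = 0
      rw [← h0, intervalIntegral.integral_of_le (hab.trans hx').le]
      refine setIntegral_eq_integral_of_forall_compl_eq_zero fun t ht => ?_
      exact image_eq_zero_of_notMem_tsupport fun h' =>
        ht ⟨(hs h').1, ((hs h').2.trans hx').le⟩
  have htsupp := closure_minimal hsupp isClosed_Icc
  refine ⟨_, ⟨contDiff_infty_iff_deriv.2 ⟨fun x => (hd x).differentiableAt, ?_⟩,
    HasCompactSupport.of_support_subset_isCompact isCompact_Icc hsupp, ?_⟩, hderiv⟩
  · rw [hderiv]; exact h.contDiff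
  · exact htsupp.trans fun x hx => ha.trans_le hx.1

/-- The lemma of du Bois-Reymond on the half-line. -/
theorem exists_isPrimitive_of_weak {g k : ℝ → ℝ} (hg : LocallyIntegrableOn g (Ioi 0))
    (hk : LocallyIntegrableOn k (Ioi 0))
    (H : ∀ ψ, IsTestHalfLine ψ →
      ∫ x in Ioi 0, g x * deriv ψ x = -∫ x in Ioi 0, k x * ψ x) :
    ∃ w, IsPrimitive w k ∧ g =ᵐ[volume.restrict (Ioi 0)] w := by
  have hK := isPrimitive_intervalIntegral hk 0
  set K : ℝ → ℝ := fun x => 0 + ∫ t in 1..x, k t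
  have hKl : LocallyIntegrableOn K (Ioi 0) := hK.continuousOn.locallyIntegrableOn measurableSet_Ioi
  obtain ⟨χ, hχ, hχ1⟩ := exists_isTestHalfLine_integral_eq_one
  set m : ℝ → ℝ := fun x => g x - K x with hm
  have hml : LocallyIntegrableOn m (Ioi 0) := hg.sub hKl
  have hm0 : ∀ ψ, IsTestHalfLine ψ → ∫ x in Ioi 0, m x * deriv ψ x = 0 := fun ψ hψ => by
    simp only [hm, sub_mul]
    rw [integral_sub (hψ.isTestHalfLine_deriv.integrableOn_mul hg) (hψ.isTestHalfLine_deriv.integrableOn_mul hKl), H ψ hψ,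
      hK.integral_mul_deriv hψ, sub_self]
  set c := ∫ x in Ioi 0, m x * χ x with hc
  have hae : ∀ᵐ x, x ∈ Ioi (0 : ℝ) → m x - c = 0 := by
    refine isOpen_Ioi.ae_eq_zero_of_integral_contDiff_smul_eq_zero
      (hml.sub (continuousOn_const.locallyIntegrableOn measurableSet_Ioi)) fun φ h1 h2 h3 => ?_
    have hφ : IsTestHalfLine φ := ⟨h1, h2, h3⟩
    -- Subtracting a multiple of `χ` makes the integral zero, so the result is the derivative of a
    -- test function and is annihilated by `m`.
    have hζ : IsTestHalfLine (fun x => φ x - (∫ y, φ y) * χ x) :=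
      ⟨h1.sub (contDiff_const.mul hχ.contDiff), h2.sub hχ.hasCompactSupport.mul_left,
        (tsupport_sub _ _).trans (union_subset h3 ((tsupport_mul_subset_right).trans
          hχ.tsupport_subset))⟩
    have hφi : Integrable φ := h1.continuous.integrable_of_hasCompactSupport h2
    have hχi : Integrable χ :=
      hχ.contDiff.continuous.integrable_of_hasCompactSupport hχ.hasCompactSupport
    obtain ⟨Z, hZ, hZd⟩ := hζ.exists_deriv_eq (by
      rw [integral_sub hφi (hχi.const_mul _), integral_const_mul, hχ1, mul_one, sub_self])
    have h4 := hm0 Z hZ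
    rw [hZd] at h4
    have h5 : ∫ x in Ioi 0, m x * φ x = (∫ y, φ y) * c := by
      have e1 : ∀ x, m x * (φ x - (∫ y, φ y) * χ x) = m x * φ x - (∫ y, φ y) * (m x * χ x) :=
        fun x => by ring
      simp only [e1] at h4
      rw [integral_sub (hφ.integrableOn_mul hml) ((hχ.integrableOn_mul hml).const_mul _),
        integral_const_mul] at h4
      linarith
    have h6 : ∫ x in Ioi 0, φ x = ∫ x, φ x :=
      setIntegral_eq_integral_of_forall_compl_eq_zero fun x hx => hφ.eq_zero (not_lt.1 hx)
    have h7 : ∫ x in Ioi 0, φ x • (m x - c) = ∫ x, φ x • (m x - c) :=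
      setIntegral_eq_integral_of_forall_compl_eq_zero fun x hx => by
        rw [hφ.eq_zero (not_lt.1 hx), zero_smul]
    rw [← h7]
    have e2 : ∀ x, φ x • (m x - c) = m x * φ x - c * φ x := fun x => by
      rw [smul_eq_mul]; ring
    simp only [e2]
    rw [integral_sub (hφ.integrableOn_mul hml) (hφi.integrableOn.const_mul _), h5,
      integral_const_mul, h6]
    ring
  refine ⟨_, isPrimitive_intervalIntegral hk c, ?_⟩
  rw [EventuallyEq, ae_restrict_iff' measurableSet_Ioi]
  filter_upwards [hae] with x hx hx0
  have := hx hx0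
  simp only [hm, K] at this
  linarith

/-! ### Polar coordinates and spherical means -/

/-- The measure `r ^ m dr` on `(0, ∞)`. -/
noncomputable def radialMeasure (m : ℕ) : Measure ℝ :=
  (volume.restrict (Ioi 0)).withDensity fun r => ENNReal.ofReal (r ^ m)

theorem map_volumeIoiPow (m : ℕ) :
    (Measure.volumeIoiPow m).map Subtype.val = radialMeasure m := by
  ext s hs
  rw [Measure.map_apply measurable_subtype_coe hs, Measure.volumeIoiPow,
    withDensity_apply _ (measurable_subtype_coe hs),
    setLIntegral_subtype measurableSet_Ioi _ fun r : ℝ => ENNReal.ofReal (r ^ m),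
    Subtype.image_preimage_coe, radialMeasure, withDensity_apply _ hs,
    Measure.restrict_restrict hs, inter_comm]

instance (m : ℕ) : SFinite (radialMeasure m) := by
  unfold radialMeasure; infer_instance

theorem integrable_radialMeasure {m : ℕ} {f : ℝ → ℝ} :
    Integrable f (radialMeasure m) ↔ IntegrableOn (fun r => r ^ m * f r) (Ioi 0) := by
  rw [radialMeasure, integrable_withDensity_iff_integrable_smul' (by fun_prop) (by simp),
    IntegrableOn]
  refine integrable_congr ?_
  filter_upwards [ae_restrict_mem measurableSet_Ioi] with r hr
  have : (0 : ℝ) < r := hr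
  rw [ENNReal.toReal_ofReal (by positivity), smul_eq_mul]

theorem integral_radialMeasure {m : ℕ} (f : ℝ → ℝ) :
    ∫ r, f r ∂radialMeasure m = ∫ r in Ioi 0, r ^ m * f r := by
  rw [radialMeasure, integral_withDensity_eq_integral_toReal_smul (by fun_prop) (by simp)]
  refine setIntegral_congr_fun measurableSet_Ioi fun r hr => ?_
  have : (0 : ℝ) < r := hr
  rw [ENNReal.toReal_ofReal (by positivity), smul_eq_mul]

theorem radialMeasure_absolutelyContinuous (m : ℕ) :
    radialMeasure m ≪ volume.restrict (Ioi 0) :=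
  withDensity_absolutelyContinuous _ _

theorem absolutelyContinuous_radialMeasure (m : ℕ) :
    volume.restrict (Ioi 0) ≪ radialMeasure m := by
  refine withDensity_absolutelyContinuous' (by fun_prop) ?_
  filter_upwards [ae_restrict_mem measurableSet_Ioi] with r hr
  have : (0 : ℝ) < r := hr
  have : 0 < r ^ m := by positivity
  simpa

theorem norm_smul_sphere {E : Type*} [NormedAddCommGroup E] [NormedSpace ℝ E] {r : ℝ} (hr : 0 ≤ r) (s : Metric.sphere (0 : E) 1) :
    ‖r • (s : E)‖ = r := by
  rw [norm_smul, norm_eq_of_mem_sphere, mul_one, Real.norm_of_nonneg hr]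

section Polar

variable {E : Type*} [NormedAddCommGroup E] [NormedSpace ℝ E] [MeasurableSpace E]
  (μ : Measure E)

/-- The mean value of `h` over the sphere of radius `r`. -/
noncomputable def sphereMean (h : E → ℝ) (r : ℝ) : ℝ :=
  ⨍ s, h (r • ((s : Metric.sphere (0 : E) 1) : E)) ∂μ.toSphere

theorem sphereMean_radial_mul (ψ : ℝ → ℝ) (h : E → ℝ) {r : ℝ} (hr : 0 ≤ r) :
    sphereMean μ (fun x => ψ ‖x‖ * h x) r = ψ r * sphereMean μ h r := by
  have : ∀ s : Metric.sphere (0 : E) 1, ψ ‖r • (s : E)‖ * h (r • (s : E)) =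
      ψ r • h (r • (s : E)) := fun s => by rw [norm_smul_sphere hr, smul_eq_mul]
  simp only [sphereMean, this, average_eq, integral_smul]
  simp only [smul_eq_mul]; ring

variable [BorelSpace E] [FiniteDimensional ℝ E] [Nontrivial E] [μ.IsAddHaarMeasure]

/-- Polar coordinates are measure preserving. -/
theorem measurePreserving_polar :
    MeasurePreserving (fun z : ℝ × Metric.sphere (0 : E) 1 => z.1 • (z.2 : E))
      ((radialMeasure (Module.finrank ℝ E - 1)).prod μ.toSphere) μ := by
  set m := Module.finrank ℝ E - 1
  have h1 : MeasurePreserving (Subtype.val : Ioi (0 : ℝ) → ℝ) (Measure.volumeIoiPow m)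
      (radialMeasure m) := ⟨measurable_subtype_coe, map_volumeIoiPow m⟩
  have h2 : MeasurePreserving (Prod.map (id : Metric.sphere (0 : E) 1 → _)
      (Subtype.val : Ioi (0 : ℝ) → ℝ)) (μ.toSphere.prod (Measure.volumeIoiPow m))
      (μ.toSphere.prod (radialMeasure m)) := (MeasurePreserving.id _).prod h1
  have h3 : MeasurePreserving (Subtype.val : ({0}ᶜ : Set E) → E) (μ.comap Subtype.val) μ := by
    refine ⟨measurable_subtype_coe, ?_⟩
    rw [(MeasurableEmbedding.subtype_coe (measurableSet_singleton _).compl).map_comap,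
      Subtype.range_coe, restrict_compl_singleton]
  have h4 : MeasurePreserving (homeomorphUnitSphereProd E).toMeasurableEquiv
      (μ.comap Subtype.val) (μ.toSphere.prod (Measure.volumeIoiPow m)) :=
    μ.measurePreserving_homeomorphUnitSphereProd
  have h5 := h3.comp (h4.symm _)
  have hmeas : Measurable (fun z : Metric.sphere (0 : E) 1 × ℝ => z.2 • (z.1 : E)) := by
    fun_prop
  have h6 : MeasurePreserving (fun z : Metric.sphere (0 : E) 1 × ℝ => z.2 • (z.1 : E))
      (μ.toSphere.prod (radialMeasure m)) μ := by
    refine ⟨hmeas, ?_⟩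
    rw [← h2.map_eq, Measure.map_map hmeas h2.measurable]
    exact h5.map_eq
  exact h6.comp Measure.measurePreserving_swap

variable {μ}

theorem sphere_real_pos : 0 < μ.toSphere.real univ := by
  rw [Measure.real, ENNReal.toReal_pos_iff]
  exact ⟨(Measure.measure_univ_ne_zero.2 μ.toSphere_ne_zero).bot_lt, measure_lt_top _ _⟩

theorem integral_sphere (h : E → ℝ) (r : ℝ) :
    ∫ s, h (r • ((s : Metric.sphere (0 : E) 1) : E)) ∂μ.toSphere =
      μ.toSphere.real univ * sphereMean μ h r := by
  rw [sphereMean, average_eq, smul_eq_mul, mul_inv_cancel_left₀ sphere_real_pos.ne']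

theorem integrable_comp_polar {h : E → ℝ} (hh : Integrable h μ) :
    Integrable (fun z : ℝ × Metric.sphere (0 : E) 1 => h (z.1 • (z.2 : E)))
      ((radialMeasure (Module.finrank ℝ E - 1)).prod μ.toSphere) :=
  ((measurePreserving_polar μ).integrable_comp hh.aestronglyMeasurable).2 hh

theorem integrableOn_sphereMean {h : E → ℝ} (hh : Integrable h μ) :
    IntegrableOn (fun r => r ^ (Module.finrank ℝ E - 1) * sphereMean μ h r) (Ioi 0) := by
  rw [← integrable_radialMeasure]
  have := (integrable_comp_polar hh).integral_prod_left
  simp only [integral_sphere] at this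
  refine (this.const_mul (μ.toSphere.real univ)⁻¹).congr (.of_forall fun r => ?_)
  simp only
  rw [inv_mul_cancel_left₀ sphere_real_pos.ne']

theorem integral_eq_sphereMean {h : E → ℝ} (hh : Integrable h μ) :
    ∫ x, h x ∂μ = μ.toSphere.real univ *
      ∫ r in Ioi 0, r ^ (Module.finrank ℝ E - 1) * sphereMean μ h r := by
  have hP := measurePreserving_polar μ
  have h1 : ∫ x, h x ∂μ = ∫ z : ℝ × Metric.sphere (0 : E) 1, h (z.1 • (z.2 : E))
      ∂((radialMeasure (Module.finrank ℝ E - 1)).prod μ.toSphere) := by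
    conv_lhs => rw [← hP.map_eq]
    exact integral_map hP.measurable.aemeasurable (hP.map_eq.symm ▸ hh.aestronglyMeasurable)
  rw [h1, integral_prod _ (integrable_comp_polar hh)]
  simp only [integral_sphere]
  rw [integral_const_mul, integral_radialMeasure]

theorem ae_ae_polar {P : E → Prop} (h : ∀ᵐ x ∂μ, P x) :
    ∀ᵐ r ∂volume.restrict (Ioi (0 : ℝ)), ∀ᵐ s : Metric.sphere (0 : E) 1 ∂μ.toSphere,
      P (r • (s : E)) :=
  (absolutelyContinuous_radialMeasure _).ae_le (Measure.ae_ae_of_ae_prod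
    ((measurePreserving_polar μ).quasiMeasurePreserving.ae h))

theorem sphereMean_ae_eq {u : E → ℝ} {f : ℝ → ℝ} (h : ∀ᵐ x ∂μ, u x = f ‖x‖) :
    sphereMean μ u =ᵐ[volume.restrict (Ioi 0)] f := by
  filter_upwards [ae_ae_polar h, ae_restrict_mem measurableSet_Ioi] with r hr hr0
  have hr0' : (0 : ℝ) < r := hr0
  have : (fun s : Metric.sphere (0 : E) 1 => u (r • (s : E))) =ᵐ[μ.toSphere] fun _ => f r := by
    filter_upwards [hr] with s hs
    rw [hs, norm_smul_sphere hr0'.le]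
  have : NeZero μ.toSphere := ⟨μ.toSphere_ne_zero⟩
  rw [sphereMean, average_congr ‹_ =ᵐ[μ.toSphere] _›, average_const]

/-- By polar coordinates, the preimage of a null set of radii under the norm is a null set. -/
theorem ae_eq_comp_norm {f g : ℝ → ℝ} (h : f =ᵐ[volume.restrict (Ioi 0)] g) :
    ∀ᵐ x ∂μ, f ‖x‖ = g ‖x‖ := by
  have hP := measurePreserving_polar μ
  have hq : Measure.QuasiMeasurePreserving (fun x : E => ‖x‖) μ (volume.restrict (Ioi 0)) := by
    refine ⟨measurable_norm, Measure.AbsolutelyContinuous.mk fun s hs hs0 => ?_⟩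
    rw [Measure.map_apply measurable_norm hs, ← hP.measure_preimage
      (measurable_norm hs).nullMeasurableSet]
    have h1 : (radialMeasure (Module.finrank ℝ E - 1)) s = 0 :=
      radialMeasure_absolutelyContinuous _ hs0
    have h2 : ∀ᵐ r ∂(radialMeasure (Module.finrank ℝ E - 1)), r ∉ s ∧ 0 < r := by
      refine (measure_eq_zero_iff_ae_notMem.1 h1).and ?_
      exact (radialMeasure_absolutelyContinuous _).ae_le (ae_restrict_mem measurableSet_Ioi)
    rw [measure_eq_zero_iff_ae_notMem]
    filter_upwards [Measure.quasiMeasurePreserving_fst.ae h2] with z hz hz'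
    rw [mem_preimage, mem_preimage, norm_smul_sphere hz.2.le] at hz'
    exact hz.1 hz'
  exact hq.ae h

/-- Jensen's inequality on the sphere of radius `r`. -/
theorem abs_sphereMean_rpow_le {p : ℝ} (hp : 1 ≤ p) {h : E → ℝ} {r : ℝ}
    (hm : AEStronglyMeasurable (fun s : Metric.sphere (0 : E) 1 => h (r • (s : E))) μ.toSphere)
    (hi : Integrable (fun s : Metric.sphere (0 : E) 1 => |h (r • (s : E))| ^ p) μ.toSphere) :
    |sphereMean μ h r| ^ p ≤ sphereMean μ (fun x => |h x| ^ p) r := by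
  have : NeZero μ.toSphere := ⟨μ.toSphere_ne_zero⟩
  have h1 : Integrable (fun s : Metric.sphere (0 : E) 1 => |h (r • (s : E))|) μ.toSphere := by
    refine Integrable.mono' (g := fun s => 1 + |h (r • (s : E))| ^ p)
      ((integrable_const 1).add hi) hm.norm (.of_forall fun s => ?_)
    rw [Real.norm_eq_abs, abs_abs]
    rcases le_total |h (r • (s : E))| 1 with h2 | h2
    · have : 0 ≤ |h (r • (s : E))| ^ p := by positivity
      linarith
    · have := Real.self_le_rpow_of_one_le h2 hp
      linarith
  have h2 := (convexOn_rpow hp).map_average_le (μ := μ.toSphere)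
    (continuousOn_id.rpow_const fun _ _ => Or.inr (by linarith)) isClosed_Ici
    (f := fun s : Metric.sphere (0 : E) 1 => |h (r • (s : E))|)
    (.of_forall fun s => mem_Ici.2 (abs_nonneg _)) h1 hi
  refine le_trans ?_ h2
  gcongr
  simp only [sphereMean, average_eq, smul_eq_mul, abs_mul]
  rw [abs_of_nonneg (inv_nonneg.2 measureReal_nonneg)]
  gcongr
  exact abs_integral_le_integral_abs

/-- Taking spherical means does not increase weighted `L^p` norms. -/
theorem integral_abs_sphereMean_rpow_le {p : ℝ} (hp : 1 ≤ p) (q : ℝ) {h : E → ℝ}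
    (hm : AEStronglyMeasurable h μ) (hi : Integrable (fun x => ‖x‖ ^ q * |h x| ^ p) μ)
    (hs : AEStronglyMeasurable (sphereMean μ h) (volume.restrict (Ioi 0))) :
    IntegrableOn (fun r => r ^ (Module.finrank ℝ E - 1) * (r ^ q * |sphereMean μ h r| ^ p))
      (Ioi 0) ∧
    μ.toSphere.real univ * (∫ r in Ioi 0,
      r ^ (Module.finrank ℝ E - 1) * (r ^ q * |sphereMean μ h r| ^ p)) ≤
      ∫ x, ‖x‖ ^ q * |h x| ^ p ∂μ := by
  have hP := measurePreserving_polar μ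
  have h1 : ∀ᵐ r ∂volume.restrict (Ioi (0 : ℝ)), AEStronglyMeasurable
      (fun s : Metric.sphere (0 : E) 1 => h (r • (s : E))) μ.toSphere :=
    (absolutelyContinuous_radialMeasure _).ae_le
      (hm.comp_quasiMeasurePreserving hP.quasiMeasurePreserving).prodMk_left
  have h2 : ∀ᵐ r ∂volume.restrict (Ioi (0 : ℝ)), Integrable (fun s : Metric.sphere (0 : E) 1 =>
      ‖r • (s : E)‖ ^ q * |h (r • (s : E))| ^ p) μ.toSphere :=
    (absolutelyContinuous_radialMeasure _).ae_le (integrable_comp_polar hi).prod_right_ae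
  have hle : ∀ᵐ r ∂volume.restrict (Ioi (0 : ℝ)),
      r ^ (Module.finrank ℝ E - 1) * (r ^ q * |sphereMean μ h r| ^ p) ≤
        r ^ (Module.finrank ℝ E - 1) * sphereMean μ (fun x => ‖x‖ ^ q * |h x| ^ p) r := by
    filter_upwards [h1, h2, ae_restrict_mem measurableSet_Ioi] with r hr1 hr2 hr0
    have hr : (0 : ℝ) < r := hr0
    have hrq : 0 < r ^ q := by positivity
    rw [sphereMean_radial_mul _ (fun t => t ^ q) (fun x => |h x| ^ p) hr.le]
    gcongr
    refine abs_sphereMean_rpow_le hp hr1 ?_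
    refine (hr2.const_mul (r ^ q)⁻¹).congr (.of_forall fun s => ?_)
    simp only
    rw [norm_smul_sphere hr.le, inv_mul_cancel_left₀ hrq.ne']
  have hI := integrableOn_sphereMean hi
  have hI' : IntegrableOn
      (fun r => r ^ (Module.finrank ℝ E - 1) * (r ^ q * |sphereMean μ h r| ^ p)) (Ioi 0) := by
    refine Integrable.mono' hI ?_ ?_
    · refine (continuous_pow _).aestronglyMeasurable.mul
        (((continuousOn_rpow_Ioi q).aestronglyMeasurable measurableSet_Ioi).mul ?_)
      exact (hs.norm.aemeasurable.pow_const p).aestronglyMeasurable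
    · filter_upwards [hle, ae_restrict_mem measurableSet_Ioi] with r hr hr0
      have : (0 : ℝ) < r := hr0
      rwa [Real.norm_of_nonneg (by positivity)]
  refine ⟨hI', ?_⟩
  rw [integral_eq_sphereMean hi]
  exact mul_le_mul_of_nonneg_left (integral_mono_ae hI' hI hle) measureReal_nonneg

/-- A compact interval of positive radii corresponds to a compact annulus avoiding the origin.
Multiplying `h` by the indicator of the annulus reduces to the globally integrable case. -/
theorem locallyIntegrableOn_sphereMean {h : E → ℝ} (hh : LocallyIntegrableOn h {0}ᶜ μ) :
    LocallyIntegrableOn (sphereMean μ h) (Ioi 0) := by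
  set m := Module.finrank ℝ E - 1
  have key : LocallyIntegrableOn (fun r => r ^ m * sphereMean μ h r) (Ioi 0) := by
    intro x hx
    have hx' : (0 : ℝ) < x := hx
    set I := Icc (x / 2) (2 * x) with hI
    refine ⟨I, mem_nhdsWithin_of_mem_nhds (Icc_mem_nhds (by linarith) (by linarith)), ?_⟩
    have hcomp : IsCompact ((fun y : E => ‖y‖) ⁻¹' I) := by
      refine (isCompact_closedBall (0 : E) (2 * x)).of_isClosed_subset
        (isClosed_Icc.preimage continuous_norm) fun y hy => ?_
      simpa using hy.2
    have h1 : IntegrableOn h ((fun y : E => ‖y‖) ⁻¹' I) μ := by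
      refine hh.integrableOn_compact_subset (fun y hy => ?_) hcomp
      have := hy.1
      refine norm_pos_iff.1 (lt_of_lt_of_le (by linarith) this)
    have h2 : Integrable (fun y => I.indicator 1 ‖y‖ * h y) μ := by
      refine (h1.integrable_indicator (measurable_norm measurableSet_Icc)).congr
        (.of_forall fun y => ?_)
      by_cases hy : ‖y‖ ∈ I
      · simp [indicator, hy]
      · simp [indicator, hy]
    have h3 := (integrableOn_sphereMean h2).mono_set
      (show I ⊆ Ioi 0 from fun y hy => lt_of_lt_of_le (by linarith) hy.1)
    refine h3.congr_fun (fun y hy => ?_) measurableSet_Icc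
    have hy0 : 0 ≤ y := le_trans (by linarith) hy.1
    simp only
    rw [sphereMean_radial_mul _ _ _ hy0, indicator_of_mem hy, Pi.one_apply, one_mul]
  have h4 : LocallyIntegrableOn (fun r => (r ^ m)⁻¹ * (r ^ m * sphereMean μ h r)) (Ioi 0) := by
    refine key.continuousOn_mul (ContinuousOn.inv₀ (by fun_prop) fun r hr => ?_)
      isOpen_Ioi.isLocallyClosed
    have : (0 : ℝ) < r := hr
    positivity
  intro x hx
  obtain ⟨s, hs, hsi⟩ := h4 x hx
  refine ⟨s ∩ Ioi 0, inter_mem hs self_mem_nhdsWithin, ?_⟩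
  have h5 : (fun r => (r ^ m)⁻¹ * (r ^ m * sphereMean μ h r)) =ᵐ[volume.restrict (s ∩ Ioi 0)]
      sphereMean μ h := by
    have := ae_restrict_mem (μ := (volume : Measure ℝ)) measurableSet_Ioi (s := Ioi (0 : ℝ))
    filter_upwards [ae_restrict_of_ae_restrict_of_subset inter_subset_right this] with r hr
    have hr0 : (0 : ℝ) < r := hr
    rw [inv_mul_cancel_left₀ (by positivity)]
  exact (hsi.mono_set inter_subset_left).congr h5

end Polar

/-! ### Differentiation of radial functions -/

section Radial

variable {E : Type*} [NormedAddCommGroup E] [InnerProductSpace ℝ E]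

theorem hasFDerivAt_comp_norm {F : ℝ → ℝ} {F' : ℝ} {x : E} (hx : x ≠ 0)
    (hF : HasDerivAt F F' ‖x‖) :
    HasFDerivAt (fun y : E => F ‖y‖) ((F' / ‖x‖) • innerSL ℝ x) x := by
  have h1 : HasFDerivAt (fun y : E => ‖y‖) (‖x‖⁻¹ • innerSL ℝ x) x := by
    have h2 := (hasStrictFDerivAt_norm_sq x).hasFDerivAt.sqrt
      (pow_ne_zero 2 (norm_ne_zero_iff.2 hx))
    simp only [Real.sqrt_sq (norm_nonneg _)] at h2
    refine h2.congr_fderiv ?_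
    ext v
    simp
    field_simp
  refine (hF.comp_hasFDerivAt x h1).congr_fderiv ?_
  rw [smul_smul, div_eq_mul_inv]

variable {ψ : ℝ → ℝ}

/-- No exception is needed at the origin: `ψ ‖·‖` vanishes near it, and the right-hand side is zero
there too. -/
theorem IsTestHalfLine.hasFDerivAt_comp_norm (h : IsTestHalfLine ψ) (x : E) :
    HasFDerivAt (fun y : E => ψ ‖y‖) ((deriv ψ ‖x‖ / ‖x‖) • innerSL ℝ x) x := by
  rcases eq_or_ne x 0 with rfl | hx
  · have h1 : (fun y : E => ψ ‖y‖) =ᶠ[𝓝 0] fun _ => 0 := by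
      have : Tendsto (fun y : E => ‖y‖) (𝓝 0) (𝓝 0) := by
        simpa using (continuous_norm (E := E)).tendsto 0
      exact this.eventually (h.eventually_eq_zero le_rfl)
    refine ((hasFDerivAt_const (0 : ℝ) (0 : E)).congr_of_eventuallyEq h1).congr_fderiv ?_
    simp
  · exact CKN.hasFDerivAt_comp_norm hx (h.differentiableAt _).hasDerivAt

theorem IsTestHalfLine.contDiff_comp_norm (h : IsTestHalfLine ψ) :
    ContDiff ℝ ∞ (fun y : E => ψ ‖y‖) := by
  rw [contDiff_iff_contDiffAt]
  intro x
  rcases eq_or_ne x 0 with rfl | hx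
  · have h1 : (fun y : E => ψ ‖y‖) =ᶠ[𝓝 0] fun _ => 0 := by
      have : Tendsto (fun y : E => ‖y‖) (𝓝 0) (𝓝 0) := by
        simpa using (continuous_norm (E := E)).tendsto 0
      exact this.eventually (h.eventually_eq_zero le_rfl)
    exact contDiffAt_const.congr_of_eventuallyEq h1
  · exact h.contDiff.contDiffAt.comp x (contDiffAt_norm ℝ hx)

theorem IsTestHalfLine.tsupport_comp_norm {E : Type*} [NormedAddCommGroup E] (h : IsTestHalfLine ψ) :
    tsupport (fun y : E => ψ ‖y‖) ⊆ {0}ᶜ := fun x hx => by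
  have : ‖x‖ ∈ tsupport ψ := tsupport_comp_subset_preimage ψ continuous_norm hx
  exact norm_pos_iff.1 (h.tsupport_subset this)

theorem IsTestHalfLine.hasCompactSupport_comp_norm [FiniteDimensional ℝ E]
    (h : IsTestHalfLine ψ) : HasCompactSupport (fun y : E => ψ ‖y‖) := by
  obtain ⟨a, b, -, -, hs⟩ := h.exists_Ioo
  refine HasCompactSupport.of_support_subset_isCompact (isCompact_closedBall (0 : E) b)
    fun x hx => ?_
  have := hs (subset_tsupport _ hx)
  simpa using this.2.le

end Radial

/-! ### Weak derivatives tested against radial fields -/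

section Euclidean

variable {N : ℕ}

local notation "𝔼" => EuclideanSpace ℝ (Fin N)

theorem IsTestHalfLine.isTest_mul {ψ : ℝ → ℝ} (h : IsTestHalfLine ψ) {g : 𝔼 → ℝ}
    (hg : ContDiff ℝ ∞ g) : IsTest (fun x : 𝔼 => ψ ‖x‖ * g x) :=
  ⟨h.contDiff_comp_norm.mul hg, h.hasCompactSupport_comp_norm.mul_right, fun h0 =>
    h.tsupport_comp_norm ((tsupport_mul_subset_left) h0) rfl⟩

theorem IsTestHalfLine.isTest {ψ : ℝ → ℝ} (h : IsTestHalfLine ψ) :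
    IsTest (fun x : 𝔼 => ψ ‖x‖) :=
  ⟨h.contDiff_comp_norm, h.hasCompactSupport_comp_norm, fun h0 => h.tsupport_comp_norm h0 rfl⟩

theorem integrable_smul_of_locallyIntegrableOn {F : Type*} [NormedAddCommGroup F]
    [NormedSpace ℝ F] {φ : 𝔼 → ℝ} {g : 𝔼 → F} (hφ : Continuous φ) (hc : HasCompactSupport φ)
    (h0 : tsupport φ ⊆ {0}ᶜ) (hg : LocallyIntegrableOn g {0}ᶜ volume) :
    Integrable (fun x => φ x • g x) := by
  rw [← integrableOn_iff_integrable_of_support_subset (s := tsupport φ)]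
  · exact (hg.integrableOn_compact_subset h0 hc).continuousOn_smul hφ.continuousOn hc
  · exact fun x hx => subset_tsupport _ (left_ne_zero_of_smul hx)

theorem integrable_smul_of_locallyIntegrableOn' {F : Type*} [NormedAddCommGroup F]
    [NormedSpace ℝ F] {φ : 𝔼 → F} {g : 𝔼 → ℝ} (hφ : Continuous φ) (hc : HasCompactSupport φ)
    (h0 : tsupport φ ⊆ {0}ᶜ) (hg : LocallyIntegrableOn g {0}ᶜ volume) :
    Integrable (fun x => g x • φ x) := by
  rw [← integrableOn_iff_integrable_of_support_subset (s := tsupport φ)]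
  · exact (hg.integrableOn_compact_subset h0 hc).smul_continuousOn hφ.continuousOn hc
  · exact fun x hx => subset_tsupport _ (right_ne_zero_of_smul hx)

theorem IsTest.tsupport_subset {φ : 𝔼 → ℝ} (h : IsTest φ) : tsupport φ ⊆ {0}ᶜ := fun _ hx hx0 =>
  h.2.2 (mem_singleton_iff.1 hx0 ▸ hx)

theorem IsTest.continuous_fderiv {φ : 𝔼 → ℝ} (h : IsTest φ) : Continuous (fderiv ℝ φ) :=
  h.1.continuous_fderiv (by simp)

theorem IsTest.continuous_gradient {φ : 𝔼 → ℝ} (h : IsTest φ) : Continuous (gradient φ) :=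
  (InnerProductSpace.toDual ℝ 𝔼).symm.continuous.comp h.continuous_fderiv

theorem tsupport_gradient_subset (φ : 𝔼 → ℝ) : tsupport (gradient φ) ⊆ tsupport φ := by
  refine closure_minimal (fun x hx => ?_) isClosed_closure
  refine support_fderiv_subset ℝ fun h => hx ?_
  rw [gradient, h, map_zero]

theorem inner_gradient (φ : 𝔼 → ℝ) (v x : 𝔼) : inner ℝ v (gradient φ x) = fderiv ℝ φ x v := by
  rw [real_inner_comm, gradient, InnerProductSpace.toDual_symm_apply]

theorem IsTest.integrable_smul_gradient {φ u : 𝔼 → ℝ} (h : IsTest φ)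
    (hu : LocallyIntegrableOn u {0}ᶜ volume) : Integrable (fun x => u x • gradient φ x) :=
  integrable_smul_of_locallyIntegrableOn' h.continuous_gradient
    (h.2.1.of_isClosed_subset isClosed_closure (tsupport_gradient_subset φ))
    ((tsupport_gradient_subset φ).trans h.tsupport_subset) hu

/-- The weak gradient tested in a direction `v`. -/
theorem HasWeakGradient.integral_mul_fderiv {u : 𝔼 → ℝ} {G : 𝔼 → 𝔼} (h : HasWeakGradient u G)
    {φ : 𝔼 → ℝ} (hφ : IsTest φ) (v : 𝔼) :
    ∫ x, u x * fderiv ℝ φ x v = -∫ x, φ x * inner ℝ v (G x) := by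
  have h1 := congrArg (fun y => inner ℝ v y) (h.2.2 φ hφ)
  simp only [inner_neg_right] at h1
  rw [← integral_inner (hφ.integrable_smul_gradient h.1),
    ← integral_inner (integrable_smul_of_locallyIntegrableOn hφ.1.continuous hφ.2.1
      hφ.tsupport_subset h.2.1)] at h1
  simpa only [inner_smul_right, inner_gradient] using h1

theorem hasFDerivAt_test_mul_coord {η : ℝ → ℝ} (h : IsTestHalfLine η) (i : Fin N) (x : 𝔼) :
    HasFDerivAt (fun y : 𝔼 => η ‖y‖ * y i)
      (η ‖x‖ • (EuclideanSpace.proj i : StrongDual ℝ 𝔼) +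
        x i • ((deriv η ‖x‖ / ‖x‖) • innerSL ℝ x)) x :=
  (h.hasFDerivAt_comp_norm x).fun_mul (EuclideanSpace.proj i : StrongDual ℝ 𝔼).hasFDerivAt

theorem fderiv_test_mul_coord {η : ℝ → ℝ} (h : IsTestHalfLine η) (i : Fin N) (x : 𝔼) :
    fderiv ℝ (fun y : 𝔼 => η ‖y‖ * y i) x (EuclideanSpace.single i 1) =
      η ‖x‖ + deriv η ‖x‖ / ‖x‖ * x i ^ 2 := by
  rw [(hasFDerivAt_test_mul_coord h i x).fderiv]
  simp [EuclideanSpace.inner_single_right]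
  ring

/-- The left-hand side is the divergence of the field `η(|x|) x`. -/
theorem sum_fderiv_test_mul_coord {η : ℝ → ℝ} (h : IsTestHalfLine η) (x : 𝔼) :
    ∑ i, fderiv ℝ (fun y : 𝔼 => η ‖y‖ * y i) x (EuclideanSpace.single i 1) =
      N * η ‖x‖ + ‖x‖ * deriv η ‖x‖ := by
  simp only [fderiv_test_mul_coord h]
  rw [Finset.sum_add_distrib, ← Finset.mul_sum, ← EuclideanSpace.real_norm_sq_eq]
  simp
  rcases eq_or_ne ‖x‖ 0 with h0 | h0
  · simp [h0]
  · field_simp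

theorem contDiff_coord (i : Fin N) : ContDiff ℝ ∞ (fun y : 𝔼 => y i) :=
  (EuclideanSpace.proj i : StrongDual ℝ 𝔼).contDiff

/-- The weak gradient tested against the vector field `η(|x|) x`. -/
theorem HasWeakGradient.integral_radial {u : 𝔼 → ℝ} {G : 𝔼 → 𝔼} (h : HasWeakGradient u G)
    {η : ℝ → ℝ} (hη : IsTestHalfLine η) :
    ∫ x, u x * (N * η ‖x‖ + ‖x‖ * deriv η ‖x‖) = -∫ x, η ‖x‖ * inner ℝ x (G x) := by
  have ht : ∀ i : Fin N, IsTest (fun y : 𝔼 => η ‖y‖ * y i) := fun i =>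
    hη.isTest_mul (contDiff_coord i)
  have h1 := fun i : Fin N => h.integral_mul_fderiv (ht i) (EuclideanSpace.single i 1)
  have e1 : ∀ x : 𝔼, u x * (N * η ‖x‖ + ‖x‖ * deriv η ‖x‖) =
      ∑ i, u x * fderiv ℝ (fun y : 𝔼 => η ‖y‖ * y i) x (EuclideanSpace.single i 1) := fun x => by
    rw [← Finset.mul_sum, sum_fderiv_test_mul_coord hη]
  have e2 : ∀ x : 𝔼, η ‖x‖ * inner ℝ x (G x) =
      ∑ i, (η ‖x‖ * x i) * inner ℝ (EuclideanSpace.single i (1 : ℝ)) (G x) := fun x => by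
    simp only [EuclideanSpace.inner_single_left, map_one, one_mul, mul_assoc]
    rw [← Finset.mul_sum, PiLp.inner_apply]
    congr 1
    exact Finset.sum_congr rfl fun i _ => by simp [mul_comm]
  simp only [e1, e2]
  rw [integral_finsetSum, integral_finsetSum, ← Finset.sum_neg_distrib]
  · exact Finset.sum_congr rfl fun i _ => h1 i
  · intro i _
    have := (integrable_smul_of_locallyIntegrableOn (ht i).1.continuous (ht i).2.1
      (ht i).tsupport_subset h.2.1).const_inner (𝕜 := ℝ) (EuclideanSpace.single i (1 : ℝ))
    simpa only [inner_smul_right] using this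
  · intro i _
    have := ((ht i).integrable_smul_gradient h.1).const_inner (𝕜 := ℝ)
      (EuclideanSpace.single i (1 : ℝ))
    simpa only [inner_smul_right, inner_gradient] using this

theorem IsTestHalfLine.deriv_div {ψ : ℝ → ℝ} (h : IsTestHalfLine ψ) :
    IsTestHalfLine (fun r => r⁻¹ * deriv ψ r) :=
  h.isTestHalfLine_deriv.of_contDiffOn fun _ hr => (contDiffAt_inv ℝ (ne_of_gt hr)).contDiffWithinAt

/-- The gradient of `ψ(|x|)` is `η(|x|) x` with `η = ψ'/r`, so the Laplacian is the divergence
already computed for such fields. -/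
theorem laplacian_comp_norm {ψ : ℝ → ℝ} (h : IsTestHalfLine ψ) (x : 𝔼) :
    (Δ (fun y : 𝔼 => ψ ‖y‖)) x = N * (‖x‖⁻¹ * deriv ψ ‖x‖) +
      ‖x‖ * deriv (fun r => r⁻¹ * deriv ψ r) ‖x‖ := by
  rw [InnerProductSpace.laplacian_eq_iteratedFDeriv_orthonormalBasis _
    (EuclideanSpace.basisFun (Fin N) ℝ)]
  simp only [EuclideanSpace.basisFun_apply, iteratedFDeriv_two_apply]
  rw [← sum_fderiv_test_mul_coord h.deriv_div]
  refine Finset.sum_congr rfl fun i _ => ?_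
  have hd : DifferentiableAt ℝ (fderiv ℝ (fun y : 𝔼 => ψ ‖y‖)) x :=
    ((h.contDiff_comp_norm (E := 𝔼)).fderiv_right (m := 1) (by norm_cast)).differentiable
      (by simp) x
  have h1 : (fun y : 𝔼 => fderiv ℝ (fun y : 𝔼 => ψ ‖y‖) y (EuclideanSpace.single i 1)) =
      fun y : 𝔼 => (‖y‖⁻¹ * deriv ψ ‖y‖) * y i := by
    ext y
    rw [(h.hasFDerivAt_comp_norm y).fderiv]
    simp [EuclideanSpace.inner_single_right, div_eq_inv_mul]
  rw [← h1, fderiv_clm_apply hd (differentiableAt_const _)]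
  simp

end Euclidean

theorem IsTestHalfLine.add {ψ χ : ℝ → ℝ} (h : IsTestHalfLine ψ) (h' : IsTestHalfLine χ) :
    IsTestHalfLine (fun r => ψ r + χ r) where
  contDiff := h.contDiff.add h'.contDiff
  hasCompactSupport := h.hasCompactSupport.add h'.hasCompactSupport
  tsupport_subset := (tsupport_add _ _).trans (union_subset h.tsupport_subset h'.tsupport_subset)

/-! ### Weak equations for spherical means and the radial profile -/

section Euclidean

variable {N : ℕ}

local notation "𝔼" => EuclideanSpace ℝ (Fin N)

/-- The radial component of a vector field. -/
noncomputable def radialComponent (G : 𝔼 → 𝔼) (x : 𝔼) : ℝ := inner ℝ x (G x) / ‖x‖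

theorem abs_radialComponent_le (G : 𝔼 → 𝔼) (x : 𝔼) : |radialComponent G x| ≤ ‖G x‖ := by
  rw [radialComponent, abs_div, abs_norm]
  refine div_le_of_le_mul₀ (norm_nonneg _) (norm_nonneg _) ?_
  rw [mul_comm]
  exact abs_real_inner_le_norm _ _

theorem aestronglyMeasurable_radialComponent {G : 𝔼 → 𝔼} {μ : Measure 𝔼}
    (hG : AEStronglyMeasurable G μ) : AEStronglyMeasurable (radialComponent G) μ :=
  ((aestronglyMeasurable_id.inner hG).aemeasurable.div
    measurable_norm.aemeasurable).aestronglyMeasurable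

theorem locallyIntegrableOn_radialComponent {G : 𝔼 → 𝔼}
    (hG : LocallyIntegrableOn G {0}ᶜ volume) :
    LocallyIntegrableOn (radialComponent G) {0}ᶜ volume := by
  intro x hx
  obtain ⟨s, hs, hi⟩ := hG x hx
  exact ⟨s, hs, Integrable.mono' hi.norm (aestronglyMeasurable_radialComponent hi.1)
    (.of_forall fun y => abs_radialComponent_le G y)⟩

theorem integrable_test_mul {ζ : ℝ → ℝ} (hζ : IsTestHalfLine ζ) {h : 𝔼 → ℝ}
    (hh : LocallyIntegrableOn h {0}ᶜ volume) : Integrable (fun x => ζ ‖x‖ * h x) :=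
  integrable_smul_of_locallyIntegrableOn (F := ℝ) hζ.isTest.1.continuous hζ.isTest.2.1
    hζ.isTest.tsupport_subset hh

/-- The weak gradient of a radial function with continuously differentiable profile. -/
theorem hasWeakGradient_radial {u : 𝔼 → ℝ} {f f' : ℝ → ℝ}
    (hf : ∀ r, 0 < r → HasDerivAt f (f' r) r) (hf' : ContinuousOn f' (Ioi 0))
    (hu : ∀ᵐ x, u x = f ‖x‖) : HasWeakGradient u (fun x => (f' ‖x‖ / ‖x‖) • x) := by
  have hmaps : MapsTo (fun x : 𝔼 => ‖x‖) {0}ᶜ (Ioi 0) := fun x hx => norm_pos_iff.2 hx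
  have hfc : ContinuousOn f (Ioi 0) := fun r hr => (hf r hr).continuousAt.continuousWithinAt
  have hUc : ContinuousOn (fun x : 𝔼 => f ‖x‖) {0}ᶜ := hfc.comp continuous_norm.continuousOn hmaps
  have hGc : ContinuousOn (fun x : 𝔼 => (f' ‖x‖ / ‖x‖) • x) {0}ᶜ :=
    ((hf'.comp continuous_norm.continuousOn hmaps).div continuous_norm.continuousOn
      fun x hx => norm_ne_zero_iff.2 hx).smul continuousOn_id
  have hms : MeasurableSet ({0}ᶜ : Set 𝔼) := (measurableSet_singleton _).compl
  have hUl : LocallyIntegrableOn (fun x : 𝔼 => f ‖x‖) {0}ᶜ volume :=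
    hUc.locallyIntegrableOn hms
  have hGl : LocallyIntegrableOn (fun x : 𝔼 => (f' ‖x‖ / ‖x‖) • x) {0}ᶜ volume :=
    hGc.locallyIntegrableOn hms
  refine ⟨LocallyIntegrableOn.congr (ae_restrict_of_ae (hu.mono fun x hx => hx.symm)) hUl, hGl,
    fun φ hφ => ?_⟩
  have h1 : ∫ x, u x • gradient φ x = ∫ x : 𝔼, f ‖x‖ • gradient φ x :=
    integral_congr_ae (hu.mono fun x hx => by simp only [hx])
  rw [h1]
  have hi1 := hφ.integrable_smul_gradient hUl
  have hi2 := integrable_smul_of_locallyIntegrableOn hφ.1.continuous hφ.2.1 hφ.tsupport_subset hGl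
  refine ext_inner_left ℝ fun v => ?_
  rw [inner_neg_right, ← integral_inner hi1, ← integral_inner hi2]
  have hd : ∀ x : 𝔼, x ≠ 0 → HasFDerivAt (fun y : 𝔼 => f ‖y‖) ((f' ‖x‖ / ‖x‖) • innerSL ℝ x) x :=
    fun x hx => hasFDerivAt_comp_norm hx (hf _ (norm_pos_iff.2 hx))
  have e2 : ∀ x : 𝔼, inner ℝ v (φ x • (f' ‖x‖ / ‖x‖) • x) =
      fderiv ℝ (fun y : 𝔼 => f ‖y‖) x v * φ x := fun x => by
    rcases eq_or_ne x 0 with rfl | hx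
    · rw [image_eq_zero_of_notMem_tsupport hφ.2.2]; simp
    · rw [(hd x hx).fderiv]
      simp [inner_smul_right, real_inner_comm]
      ring
  have hi1' := hi1.const_inner (𝕜 := ℝ) v
  have hi2' := hi2.const_inner (𝕜 := ℝ) v
  simp only [e2] at hi2' ⊢
  simp only [inner_smul_right, inner_gradient] at hi1' ⊢
  -- Differentiability of `f ‖·‖` is needed only on the support of `φ`, away from the origin.
  refine integral_mul_fderiv_eq_neg_fderiv_mul_of_integrable hi2' hi1' ?_ ?_ ?_
  · exact integrable_smul_of_locallyIntegrableOn' (F := ℝ) hφ.1.continuous hφ.2.1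
      hφ.tsupport_subset hUl
  · exact fun x hx => (hd x (hφ.tsupport_subset hx)).differentiableAt
  · exact fun x _ => (hφ.1.differentiable (by simp)) x

variable [NeZero N]

instance : Nontrivial 𝔼 :=
  ⟨EuclideanSpace.single 0 1, 0, fun h => by simpa using congrArg (fun x : 𝔼 => x 0) h⟩

theorem integral_test_mul {ζ : ℝ → ℝ} (hζ : IsTestHalfLine ζ) {h : 𝔼 → ℝ}
    (hh : LocallyIntegrableOn h {0}ᶜ volume) :
    ∫ x, ζ ‖x‖ * h x = (volume : Measure 𝔼).toSphere.real univ *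
      ∫ r in Ioi 0, r ^ (N - 1) * (ζ r * sphereMean volume h r) := by
  rw [integral_eq_sphereMean (integrable_test_mul hζ hh), finrank_euclideanSpace_fin]
  congr 1
  refine setIntegral_congr_fun measurableSet_Ioi fun r hr => ?_
  have hr0 : (0 : ℝ) < r := hr
  rw [sphereMean_radial_mul _ _ _ hr0.le]

theorem contDiffOn_pow_inv (n : ℕ) : ContDiffOn ℝ ∞ (fun r : ℝ => (r ^ n)⁻¹) (Ioi 0) :=
  (contDiff_id.pow n).contDiffOn.inv fun _ hr => pow_ne_zero _ (ne_of_gt hr)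

/-- The radial component of the weak gradient is the weak derivative of the radial profile. -/
theorem HasWeakGradient.sphereMean {u : 𝔼 → ℝ} {G : 𝔼 → 𝔼} (h : HasWeakGradient u G)
    {θ : ℝ → ℝ} (hθ : IsTestHalfLine θ) :
    ∫ r in Ioi 0, CKN.sphereMean volume u r * deriv θ r =
      -∫ r in Ioi 0, CKN.sphereMean volume (radialComponent G) r * θ r := by
  -- With this choice `r^(N-1) (N η + r η') = θ'`: the Jacobian and the dimensional term disappear.
  set η : ℝ → ℝ := fun r => (r ^ N)⁻¹ * θ r with hη
  have hηt : IsTestHalfLine η := hθ.of_contDiffOn (contDiffOn_pow_inv N)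
  have hξ : IsTestHalfLine (fun r => N * η r + r * deriv η r) :=
    (hηt.of_contDiffOn contDiffOn_const).add
      (hηt.isTestHalfLine_deriv.of_contDiffOn contDiff_id.contDiffOn)
  have hζ : IsTestHalfLine (fun r => r * η r) := hηt.of_contDiffOn contDiff_id.contDiffOn
  have h1 := h.integral_radial hηt
  have e1 : ∀ x : 𝔼, u x * (N * η ‖x‖ + ‖x‖ * deriv η ‖x‖) =
      (N * η ‖x‖ + ‖x‖ * deriv η ‖x‖) * u x := fun x => mul_comm _ _
  have e2 : ∀ x : 𝔼, η ‖x‖ * inner ℝ x (G x) = (‖x‖ * η ‖x‖) * radialComponent G x := fun x => by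
    rw [radialComponent]
    rcases eq_or_ne x 0 with rfl | hx
    · simp
    · have := norm_ne_zero_iff.2 hx
      field_simp
  simp only [e1, e2] at h1
  rw [integral_test_mul hξ h.1, integral_test_mul hζ (locallyIntegrableOn_radialComponent h.2.1),
    ← mul_neg] at h1
  have h2 := mul_left_cancel₀ (sphere_real_pos (μ := (volume : Measure 𝔼))).ne' h1
  have hN : N - 1 + 1 = N := Nat.sub_add_cancel (NeZero.one_le)
  have e3 : ∀ r ∈ Ioi (0 : ℝ), r ^ (N - 1) *
      ((N * η r + r * deriv η r) * CKN.sphereMean volume u r) =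
      CKN.sphereMean volume u r * deriv θ r := fun r hr => by
    have hr0 : (0 : ℝ) < r := hr
    have hd : HasDerivAt η (-(N * r ^ (N - 1)) / (r ^ N) ^ 2 * θ r + (r ^ N)⁻¹ * deriv θ r) r :=
      ((hasDerivAt_pow N r).inv (by positivity)).mul (hθ.differentiableAt r).hasDerivAt
    rw [hd.deriv]
    simp only [hη]
    have : r ^ N = r ^ (N - 1) * r := by rw [← pow_succ, hN]
    rw [this]
    have : r ^ (N - 1) ≠ 0 := by positivity
    field_simp
    ring
  have e4 : ∀ r ∈ Ioi (0 : ℝ), r ^ (N - 1) *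
      (r * η r * CKN.sphereMean volume (radialComponent G) r) =
      CKN.sphereMean volume (radialComponent G) r * θ r := fun r hr => by
    have hr0 : (0 : ℝ) < r := hr
    simp only [hη]
    have : r ^ N = r ^ (N - 1) * r := by rw [← pow_succ, hN]
    rw [this]
    have : r ^ (N - 1) ≠ 0 := by positivity
    field_simp
  rwa [setIntegral_congr_fun measurableSet_Ioi e3, setIntegral_congr_fun measurableSet_Ioi e4] at h2

/-- The weak Laplacian in polar coordinates. -/
theorem HasWeakLaplacian.sphereMean {u L : 𝔼 → ℝ} {G : 𝔼 → 𝔼} (hL : HasWeakLaplacian u L)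
    (hG : HasWeakGradient u G) {ψ : ℝ → ℝ} (hψ : IsTestHalfLine ψ) :
    ∫ r in Ioi 0, (r ^ (N - 1) * CKN.sphereMean volume (radialComponent G) r) * deriv ψ r =
      -∫ r in Ioi 0, (r ^ (N - 1) * CKN.sphereMean volume L r) * ψ r := by
  have h1 := hL.2.2 _ hψ.isTest
  -- Testing the gradient against `∇ψ(|x|)` expresses `∫ u Δψ` through the radial component of `G`.
  have h2 := hG.integral_radial hψ.deriv_div
  simp only [laplacian_comp_norm hψ] at h1
  rw [h1] at h2
  have e2 : ∀ x : 𝔼, ‖x‖⁻¹ * deriv ψ ‖x‖ * inner ℝ x (G x) =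
      deriv ψ ‖x‖ * radialComponent G x := fun x => by
    rw [radialComponent]; ring
  simp only [e2] at h2
  rw [integral_test_mul hψ hL.2.1, integral_test_mul hψ.isTestHalfLine_deriv
    (locallyIntegrableOn_radialComponent hG.2.1), ← mul_neg] at h2
  have h3 := mul_left_cancel₀ (sphere_real_pos (μ := (volume : Measure 𝔼))).ne' h2
  have e3 : ∀ r : ℝ, (r ^ (N - 1) * CKN.sphereMean volume (radialComponent G) r) * deriv ψ r =
      r ^ (N - 1) * (deriv ψ r * CKN.sphereMean volume (radialComponent G) r) := fun r => by ring
  have e4 : ∀ r : ℝ, (r ^ (N - 1) * CKN.sphereMean volume L r) * ψ r =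
      r ^ (N - 1) * (ψ r * CKN.sphereMean volume L r) := fun r => by ring
  simp only [e3, e4]
  rw [h3, neg_neg]

/-- A primitive sees its derivative only almost everywhere; a continuous representative of that
derivative makes the primitive differentiable at every point. -/
theorem IsPrimitive.hasDerivAt_of_ae_eq {f k k' : ℝ → ℝ} (h : IsPrimitive f k)
    (hk : k =ᵐ[volume.restrict (Ioi 0)] k') (hk' : ContinuousOn k' (Ioi 0)) {x : ℝ} (hx : 0 < x) :
    HasDerivAt f (k' x) x := by
  have h1 : EqOn f (fun y => f x + ∫ t in x..y, k' t) (Ioi 0) := fun y hy => by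
    rw [h.eqOn hx hy]
    simp only
    congr 1
    refine intervalIntegral.integral_congr_ae ?_
    rw [EventuallyEq, ae_restrict_iff' measurableSet_Ioi] at hk
    filter_upwards [hk] with t ht hty
    exact ht (uIcc_subset_Ioi hx hy (uIoc_subset_uIcc hty))
  have h2 : HasDerivAt (fun y => ∫ t in x..y, k' t) (k' x) x :=
    intervalIntegral.integral_hasDerivAt_right (by simp)
      (hk'.stronglyMeasurableAtFilter isOpen_Ioi x hx) (hk'.continuousAt (Ioi_mem_nhds hx))
  refine (h2.const_add (f x)).congr_of_eventuallyEq ?_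
  filter_upwards [Ioi_mem_nhds hx] with y hy using h1 hy

/-- A radial function with weak gradient and weak Laplacian has a continuously differentiable
profile, and `r ^ (N-1)` times its derivative is absolutely continuous. -/
theorem exists_radial_profile {u L : 𝔼 → ℝ} {G : 𝔼 → 𝔼} (hL : HasWeakLaplacian u L)
    (hG : HasWeakGradient u G) (hu : IsRadial u) :
    ∃ f w : ℝ → ℝ, IsPrimitive w (fun r => r ^ (N - 1) * sphereMean volume L r) ∧
      (∀ r, 0 < r → HasDerivAt f ((r ^ (N - 1))⁻¹ * w r) r) ∧
      (∀ᵐ x, u x = f ‖x‖) ∧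
      sphereMean volume (radialComponent G) =ᵐ[volume.restrict (Ioi 0)]
        fun r => (r ^ (N - 1))⁻¹ * w r := by
  have hg := locallyIntegrableOn_sphereMean (locallyIntegrableOn_radialComponent hG.2.1)
  have hpow : ∀ k : ℝ → ℝ, LocallyIntegrableOn k (Ioi 0) →
      LocallyIntegrableOn (fun r => r ^ (N - 1) * k r) (Ioi 0) := fun k hk =>
    hk.continuousOn_mul (by fun_prop) isOpen_Ioi.isLocallyClosed
  -- The Laplacian makes `r^(N-1)` times the mean radial derivative absolutely continuous. That
  -- derivative is then continuous up to a null set, which upgrades the profile `f` obtained next to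
  -- `C^1`.
  obtain ⟨w, hw, hwe⟩ := exists_isPrimitive_of_weak (hpow _ hg)
    (hpow _ (locallyIntegrableOn_sphereMean hL.2.1)) fun ψ hψ => hL.sphereMean hG hψ
  obtain ⟨f, hf, hfe⟩ := exists_isPrimitive_of_weak (locallyIntegrableOn_sphereMean hG.1) hg
    fun ψ hψ => hG.sphereMean hψ
  have hge : sphereMean volume (radialComponent G) =ᵐ[volume.restrict (Ioi 0)]
      fun r => (r ^ (N - 1))⁻¹ * w r := by
    filter_upwards [hwe, ae_restrict_mem measurableSet_Ioi] with r hr hr0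
    have : (0 : ℝ) < r := hr0
    rw [← hr, inv_mul_cancel_left₀ (by positivity)]
  refine ⟨f, w, hw, fun r hr => hf.hasDerivAt_of_ae_eq hge
    ((contDiffOn_pow_inv _).continuousOn.mul hw.continuousOn) hr, ?_, hge⟩
  obtain ⟨f₀, hf₀⟩ := hu
  have h1 : f₀ =ᵐ[volume.restrict (Ioi 0)] f := (sphereMean_ae_eq hf₀).symm.trans hfe
  filter_upwards [hf₀, ae_eq_comp_norm (μ := (volume : Measure 𝔼)) h1] with x hx1 hx2
  rw [hx1, hx2]

end Euclidean

/-! ### Test functions have weak derivatives; finiteness of norms on the closure -/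

section Euclidean

variable {N : ℕ}

local notation "𝔼" => EuclideanSpace ℝ (Fin N)

theorem IsTest.integral_mul_fderiv {φ χ : 𝔼 → ℝ} (hφ : IsTest φ) (hχ : IsTest χ) (v : 𝔼) :
    ∫ x, φ x * fderiv ℝ χ x v = -∫ x, fderiv ℝ φ x v * χ x := by
  have hφc := hφ.1.continuous
  have hχc := hχ.1.continuous
  have hφd : Continuous fun x => fderiv ℝ φ x v := hφ.continuous_fderiv.clm_apply continuous_const
  have hχd : Continuous fun x => fderiv ℝ χ x v := hχ.continuous_fderiv.clm_apply continuous_const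
  refine integral_mul_fderiv_eq_neg_fderiv_mul_of_integrable ?_ ?_ ?_
    (fun x _ => hφ.1.differentiable (by simp) x) (fun x _ => hχ.1.differentiable (by simp) x)
  · exact (hφd.mul hχc).integrable_of_hasCompactSupport hχ.2.1.mul_left
  · exact (hφc.mul hχd).integrable_of_hasCompactSupport hφ.2.1.mul_right
  · exact (hφc.mul hχc).integrable_of_hasCompactSupport hφ.2.1.mul_right

theorem IsTest.fderiv_apply {φ : 𝔼 → ℝ} (hφ : IsTest φ) (v : 𝔼) :
    IsTest (fun x => fderiv ℝ φ x v) := by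
  have hsub : tsupport (fun x => fderiv ℝ φ x v) ⊆ tsupport φ :=
    closure_minimal (fun x hx => support_fderiv_subset ℝ fun h => hx (by
      simp only [h, _root_.zero_apply])) isClosed_closure
  exact ⟨(hφ.1.fderiv_right (m := ∞) (by norm_cast)).clm_apply contDiff_const,
    hφ.2.1.of_isClosed_subset isClosed_closure hsub, fun h => hφ.2.2 (hsub h)⟩

theorem IsTest.laplacian_eq {φ : 𝔼 → ℝ} (hφ : IsTest φ) (x : 𝔼) :
    (Δ φ) x = ∑ i, fderiv ℝ (fun y => fderiv ℝ φ y (EuclideanSpace.single i 1)) x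
      (EuclideanSpace.single i 1) := by
  rw [InnerProductSpace.laplacian_eq_iteratedFDeriv_orthonormalBasis _
    (EuclideanSpace.basisFun (Fin N) ℝ)]
  simp only [EuclideanSpace.basisFun_apply, iteratedFDeriv_two_apply]
  refine Finset.sum_congr rfl fun i _ => ?_
  have hd : DifferentiableAt ℝ (fderiv ℝ φ) x :=
    (hφ.1.fderiv_right (m := 1) (by norm_cast)).differentiable (by simp) x
  rw [fderiv_clm_apply hd (differentiableAt_const _)]
  simp

theorem IsTest.isTest_laplacian {φ : 𝔼 → ℝ} (hφ : IsTest φ) : IsTest (Δ φ) := by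
  have h : ∀ i : Fin N, IsTest (fun x => fderiv ℝ (fun y => fderiv ℝ φ y
      (EuclideanSpace.single i 1)) x (EuclideanSpace.single i 1)) := fun i =>
    (hφ.fderiv_apply _).fderiv_apply _
  have hsub : tsupport (Δ φ) ⊆ tsupport φ := by
    refine closure_minimal (fun x hx => ?_) isClosed_closure
    by_contra hx'
    refine hx ?_
    rw [hφ.laplacian_eq]
    refine Finset.sum_eq_zero fun i _ => ?_
    have h0 : (fun y => fderiv ℝ φ y (EuclideanSpace.single i 1)) =ᶠ[𝓝 x] fun _ => 0 := by
      have := (notMem_tsupport_iff_eventuallyEq.1 hx').fderiv (𝕜 := ℝ)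
      filter_upwards [this] with y hy
      rw [hy]; simp
    rw [h0.fderiv_eq]; simp
  refine ⟨?_, hφ.2.1.of_isClosed_subset isClosed_closure hsub, fun h => hφ.2.2 (hsub h)⟩
  rw [funext hφ.laplacian_eq]
  exact ContDiff.sum fun i _ => (h i).1

theorem Continuous.locallyIntegrableOn_compl {F : Type*} [NormedAddCommGroup F] {f : 𝔼 → F}
    (hf : Continuous f) : LocallyIntegrableOn f {0}ᶜ volume :=
  hf.locallyIntegrable.locallyIntegrableOn _

theorem IsTest.hasWeakGradient {φ : 𝔼 → ℝ} (hφ : IsTest φ) : HasWeakGradient φ (gradient φ) := by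
  have hl := Continuous.locallyIntegrableOn_compl hφ.1.continuous
  have hl' := Continuous.locallyIntegrableOn_compl hφ.continuous_gradient
  refine ⟨hl, hl', fun χ hχ => ext_inner_left ℝ fun v => ?_⟩
  rw [inner_neg_right, ← integral_inner (hχ.integrable_smul_gradient hl),
    ← integral_inner (integrable_smul_of_locallyIntegrableOn hχ.1.continuous hχ.2.1
      hχ.tsupport_subset hl')]
  simp only [inner_smul_right, inner_gradient]
  rw [hφ.integral_mul_fderiv hχ]
  simp only [mul_comm]

theorem IsTest.hasWeakLaplacian {φ : 𝔼 → ℝ} (hφ : IsTest φ) : HasWeakLaplacian φ (Δ φ) := by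
  refine ⟨Continuous.locallyIntegrableOn_compl hφ.1.continuous,
    Continuous.locallyIntegrableOn_compl hφ.isTest_laplacian.1.continuous, fun χ hχ => ?_⟩
  have hi : ∀ f g : 𝔼 → ℝ, IsTest f → IsTest g → Integrable (fun x => f x * g x) :=
    fun f g hf hg => (hf.1.continuous.mul hg.1.continuous).integrable_of_hasCompactSupport
      hf.2.1.mul_right
  simp only [hφ.laplacian_eq, hχ.laplacian_eq, Finset.mul_sum]
  rw [integral_finsetSum _ fun i _ => hi _ _ hφ ((hχ.fderiv_apply _).fderiv_apply _),
    integral_finsetSum _ fun i _ => hi _ _ hχ ((hφ.fderiv_apply _).fderiv_apply _)]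
  refine Finset.sum_congr rfl fun i _ => ?_
  rw [hφ.integral_mul_fderiv (hχ.fderiv_apply _), hχ.integral_mul_fderiv (hφ.fderiv_apply _)]
  simp only [mul_comm]

theorem HasWeakGradient.add {u v : 𝔼 → ℝ} {G H : 𝔼 → 𝔼} (hu : HasWeakGradient u G)
    (hv : HasWeakGradient v H) : HasWeakGradient (u + v) (G + H) := by
  refine ⟨hu.1.add hv.1, hu.2.1.add hv.2.1, fun φ hφ => ?_⟩
  simp only [Pi.add_apply, add_smul, smul_add]
  rw [integral_add (hφ.integrable_smul_gradient hu.1) (hφ.integrable_smul_gradient hv.1),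
    integral_add (integrable_smul_of_locallyIntegrableOn hφ.1.continuous hφ.2.1
      hφ.tsupport_subset hu.2.1) (integrable_smul_of_locallyIntegrableOn hφ.1.continuous hφ.2.1
      hφ.tsupport_subset hv.2.1), hu.2.2 φ hφ, hv.2.2 φ hφ, neg_add]

theorem HasWeakLaplacian.add {u v L M : 𝔼 → ℝ} (hu : HasWeakLaplacian u L)
    (hv : HasWeakLaplacian v M) : HasWeakLaplacian (u + v) (L + M) := by
  refine ⟨hu.1.add hv.1, hu.2.1.add hv.2.1, fun φ hφ => ?_⟩
  have h1 : ∀ f : 𝔼 → ℝ, LocallyIntegrableOn f {0}ᶜ volume →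
      Integrable (fun x => f x * (Δ φ) x) := fun f hf =>
    integrable_smul_of_locallyIntegrableOn' (F := ℝ) hφ.isTest_laplacian.1.continuous
      hφ.isTest_laplacian.2.1 hφ.isTest_laplacian.tsupport_subset hf
  have h2 : ∀ f : 𝔼 → ℝ, LocallyIntegrableOn f {0}ᶜ volume →
      Integrable (fun x => φ x * f x) := fun f hf =>
    integrable_smul_of_locallyIntegrableOn (F := ℝ) hφ.1.continuous hφ.2.1 hφ.tsupport_subset hf
  simp only [Pi.add_apply, add_mul, mul_add]
  rw [integral_add (h1 _ hu.1) (h1 _ hv.1), integral_add (h2 _ hu.2.1) (h2 _ hv.2.1),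
    hu.2.2 φ hφ, hv.2.2 φ hφ]

theorem aestronglyMeasurable_of_locallyIntegrableOn_compl [NeZero N] {F : Type*}
    [NormedAddCommGroup F] {f : 𝔼 → F}
    (hf : LocallyIntegrableOn f {0}ᶜ volume) : AEStronglyMeasurable f volume := by
  have := hf.aestronglyMeasurable
  rwa [restrict_compl_singleton] at this

variable {F : Type*} [NormedAddCommGroup F] [NormedSpace ℝ F]

theorem weightedNorm_ne_top_of_hasCompactSupport (p a : ℝ) {f : 𝔼 → F} (hf : Continuous f)
    (hc : HasCompactSupport f) (h0 : tsupport f ⊆ {0}ᶜ) : weightedNorm p a f ≠ ⊤ := by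
  have hc' : HasCompactSupport (fun x : 𝔼 => ‖x‖ ^ (-a) • f x) := hc.smul_left
  have hcont : Continuous (fun x : 𝔼 => ‖x‖ ^ (-a) • f x) := by
    refine continuous_of_tsupport fun x hx => ?_
    have hx0 : x ≠ 0 := h0 (tsupport_smul_subset_right (fun x : 𝔼 => ‖x‖ ^ (-a)) f hx)
    exact (continuous_norm.continuousAt.rpow_const (Or.inl (norm_ne_zero_iff.2 hx0))).smul
      hf.continuousAt
  exact (hcont.memLp_of_hasCompactSupport hc').2.ne

theorem weightedNorm_add_le {p : ℝ} (hp : 1 ≤ p) (a : ℝ) {f g : 𝔼 → F}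
    (hf : AEStronglyMeasurable f volume) (hg : AEStronglyMeasurable g volume) :
    weightedNorm p a (f + g) ≤ weightedNorm p a f + weightedNorm p a g := by
  have hw : AEStronglyMeasurable (fun x : 𝔼 => ‖x‖ ^ (-a)) volume :=
    (measurable_norm.pow_const _).aestronglyMeasurable
  have hf' : AEStronglyMeasurable (fun x : 𝔼 => ‖x‖ ^ (-a) • f x) volume := hw.smul hf
  have hg' : AEStronglyMeasurable (fun x : 𝔼 => ‖x‖ ^ (-a) • g x) volume := hw.smul hg
  have he : (fun x : 𝔼 => ‖x‖ ^ (-a) • (f + g) x) =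
      (fun x : 𝔼 => ‖x‖ ^ (-a) • f x) + fun x : 𝔼 => ‖x‖ ^ (-a) • g x := by
    ext x
    simp only [Pi.add_apply, smul_add]
  unfold weightedNorm
  rw [he]
  exact eLpNorm_add_le hf' hg' (ENNReal.one_le_ofReal.2 hp)

/-- Elements of the closure of the test functions have finite norms. -/
theorem MemSecondOrderSpace.ne_top [NeZero N] {p a b : ℝ} (hp : 1 ≤ p) {u : 𝔼 → ℝ}
    (hu : MemSecondOrderSpace p p b a u) : laplacianNorm p b u ≠ ⊤ ∧ hNorm p a u ≠ ⊤ := by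
  obtain ⟨φ, hφ, hlim⟩ := hu
  -- A single approximant at finite distance suffices.
  obtain ⟨n, hn⟩ := (hlim.eventually (gt_mem_nhds ENNReal.zero_lt_top)).exists
  rw [ENNReal.add_lt_top] at hn
  have huφ : u - φ n + φ n = u := sub_add_cancel _ _
  constructor
  · obtain ⟨L, hL⟩ := iInf_lt_iff.1 hn.1
    obtain ⟨hL, hLt⟩ := iInf_lt_iff.1 hL
    have h1 := hL.add (hφ n).hasWeakLaplacian
    rw [huφ] at h1
    refine ne_top_of_le_ne_top ?_ (iInf₂_le _ h1)
    refine ne_top_of_le_ne_top (ENNReal.add_ne_top.2 ⟨hLt.ne, ?_⟩) (weightedNorm_add_le hp b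
      (aestronglyMeasurable_of_locallyIntegrableOn_compl hL.2.1)
      (hφ n).isTest_laplacian.1.continuous.aestronglyMeasurable)
    exact weightedNorm_ne_top_of_hasCompactSupport p b (hφ n).isTest_laplacian.1.continuous
      (hφ n).isTest_laplacian.2.1 (hφ n).isTest_laplacian.tsupport_subset
  · obtain ⟨G, hG⟩ := iInf_lt_iff.1 hn.2
    obtain ⟨hG, hGt⟩ := iInf_lt_iff.1 hG
    have h1 := hG.add (hφ n).hasWeakGradient
    rw [huφ] at h1
    refine ne_top_of_le_ne_top ?_ (iInf₂_le _ h1)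
    refine ne_top_of_le_ne_top (ENNReal.add_ne_top.2 ⟨hGt.ne, ?_⟩) (weightedNorm_add_le hp a
      (aestronglyMeasurable_of_locallyIntegrableOn_compl hG.2.1)
      (hφ n).continuous_gradient.aestronglyMeasurable)
    exact weightedNorm_ne_top_of_hasCompactSupport p a (hφ n).continuous_gradient
      ((hφ n).2.1.of_isClosed_subset isClosed_closure (tsupport_gradient_subset _))
      ((tsupport_gradient_subset _).trans (hφ n).tsupport_subset)

end Euclidean

/-! ### Weighted norms of radial functions and stability on `ℝ^N` -/

section Euclidean

variable {N : ℕ}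

local notation "𝔼" => EuclideanSpace ℝ (Fin N)

theorem norm_weight_smul_rpow {F : Type*} [NormedAddCommGroup F] [NormedSpace ℝ F] (p a : ℝ)
    (x : 𝔼) (y : F) : ‖‖x‖ ^ (-a) • y‖ ^ p = ‖x‖ ^ (-(p * a)) * ‖y‖ ^ p := by
  rw [norm_smul, Real.norm_of_nonneg (by positivity), Real.mul_rpow (by positivity)
    (norm_nonneg _), ← Real.rpow_mul (norm_nonneg _)]
  congr 2
  ring

variable {F : Type*} [NormedAddCommGroup F] [NormedSpace ℝ F]

theorem memLp_weight_iff {p : ℝ} (hp : 0 < p) (a : ℝ) {f : 𝔼 → F}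
    (hf : AEStronglyMeasurable f volume) :
    MemLp (fun x : 𝔼 => ‖x‖ ^ (-a) • f x) (ENNReal.ofReal p) volume ↔
      Integrable (fun x : 𝔼 => ‖x‖ ^ (-(p * a)) * ‖f x‖ ^ p) := by
  have hw : AEStronglyMeasurable (fun x : 𝔼 => ‖x‖ ^ (-a)) volume :=
    (measurable_norm.pow_const _).aestronglyMeasurable
  have hm : AEStronglyMeasurable (fun x : 𝔼 => ‖x‖ ^ (-a) • f x) volume := hw.smul hf
  rw [← integrable_norm_rpow_iff hm (ENNReal.ofReal_pos.2 hp).ne' ENNReal.ofReal_ne_top,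
    ENNReal.toReal_ofReal hp.le]
  simp only [norm_weight_smul_rpow]

theorem weightedNorm_eq {p : ℝ} (hp : 0 < p) (a : ℝ) {f : 𝔼 → F}
    (hf : AEStronglyMeasurable f volume)
    (hi : Integrable (fun x : 𝔼 => ‖x‖ ^ (-(p * a)) * ‖f x‖ ^ p)) :
    weightedNorm p a f =
      ENNReal.ofReal ((∫ x : 𝔼, ‖x‖ ^ (-(p * a)) * ‖f x‖ ^ p) ^ (1 / p)) := by
  rw [weightedNorm, MemLp.eLpNorm_eq_integral_rpow_norm (ENNReal.ofReal_pos.2 hp).ne'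
    ENNReal.ofReal_ne_top ((memLp_weight_iff hp a hf).2 hi), ENNReal.toReal_ofReal hp.le]
  simp only [norm_weight_smul_rpow, one_div]

theorem integrable_of_weightedNorm_ne_top {p : ℝ} (hp : 0 < p) (a : ℝ) {f : 𝔼 → F}
    (hf : AEStronglyMeasurable f volume) (h : weightedNorm p a f ≠ ⊤) :
    Integrable (fun x : 𝔼 => ‖x‖ ^ (-(p * a)) * ‖f x‖ ^ p) := by
  have hw : AEStronglyMeasurable (fun x : 𝔼 => ‖x‖ ^ (-a)) volume :=
    (measurable_norm.pow_const _).aestronglyMeasurable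
  exact (memLp_weight_iff hp a hf).1 ⟨hw.smul hf, h.lt_top⟩

theorem integrableOn_profile {β lam x : ℝ} (hN : 2 < N) (hβ : 0 < β) (hlam : 0 < lam)
    (hx : 0 < x) :
    IntegrableOn (fun r : ℝ => r ^ (1 - (N : ℝ)) * Real.exp (-(lam * r ^ β) / β)) (Ioi x) := by
  have hN' : (2 : ℝ) < N := by exact_mod_cast hN
  refine Integrable.mono' (integrableOn_Ioi_rpow_of_lt (a := 1 - (N : ℝ)) (by linarith) hx) ?_ ?_
  · exact ((measurable_id.pow_const _).mul
      (((measurable_id.pow_const _).const_mul lam).neg.div_const β).exp).aestronglyMeasurable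
  · filter_upwards [ae_restrict_mem measurableSet_Ioi] with r hr
    have hr0 : 0 < r := hx.trans hr
    rw [Real.norm_of_nonneg (by positivity)]
    refine mul_le_of_le_one_right (by positivity) (Real.exp_le_one_iff.2 ?_)
    exact div_nonpos_of_nonpos_of_nonneg (by simp; positivity) hβ.le

variable [NeZero N]

/-- The weighted norm of a radial function with continuously differentiable profile. -/
theorem hNorm_rpow_le_of_radial {p : ℝ} (hp : 0 < p) (c : ℝ) {u : 𝔼 → ℝ} {f f' : ℝ → ℝ}
    (hf : ∀ r, 0 < r → HasDerivAt f (f' r) r) (hf' : ContinuousOn f' (Ioi 0))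
    (hu : ∀ᵐ x, u x = f ‖x‖)
    (hi : IntegrableOn (fun r => r ^ (N - 1) * (r ^ (-(p * c)) * |f' r| ^ p)) (Ioi 0)) :
    hNorm p c u ^ p ≤ ENNReal.ofReal ((volume : Measure 𝔼).toSphere.real univ *
      ∫ r in Ioi 0, r ^ (N - 1) * (r ^ (-(p * c)) * |f' r| ^ p)) := by
  have hG := hasWeakGradient_radial hf hf' hu
  have hm := aestronglyMeasurable_of_locallyIntegrableOn_compl hG.2.1
  have hae : (fun x : 𝔼 => ‖x‖ ^ (-(p * c)) * |f' ‖x‖| ^ p) =ᵐ[volume]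
      fun x : 𝔼 => ‖x‖ ^ (-(p * c)) * ‖(f' ‖x‖ / ‖x‖) • x‖ ^ p := by
    have h0 : ∀ᵐ x : 𝔼, x ≠ 0 := by simp [ae_iff, measure_singleton]
    filter_upwards [h0] with x hx
    have hx0 := norm_ne_zero_iff.2 hx
    rw [norm_smul, norm_div, norm_norm, div_mul_cancel₀ _ hx0, Real.norm_eq_abs]
  have hi' : Integrable (fun x : 𝔼 => ‖x‖ ^ (-(p * c)) * |f' ‖x‖| ^ p) := by
    rw [integrable_fun_norm_addHaar volume (f := fun r => r ^ (-(p * c)) * |f' r| ^ p),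
      finrank_euclideanSpace_fin]
    exact hi
  -- The classical gradient is one competitor in the infimum. Only upper bounds on the `H^p_c` norms
  -- are needed later, so uniqueness of weak gradients plays no role.
  have hle : hNorm p c u ≤ weightedNorm p c (fun x : 𝔼 => (f' ‖x‖ / ‖x‖) • x) := iInf₂_le _ hG
  refine (ENNReal.rpow_le_rpow hle hp.le).trans (le_of_eq ?_)
  rw [weightedNorm_eq hp c hm (hi'.congr hae), ← integral_congr_ae hae,
    integral_fun_norm_addHaar volume (fun r => r ^ (-(p * c)) * |f' r| ^ p),
    Measure.toSphere_real_apply_univ, finrank_euclideanSpace_fin]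
  simp only [smul_eq_mul, nsmul_eq_mul]
  rw [← mul_assoc]
  have hI : 0 ≤ ∫ r in Ioi (0 : ℝ), r ^ (N - 1) * (r ^ (-(p * c)) * |f' r| ^ p) :=
    setIntegral_nonneg measurableSet_Ioi fun r hr => by
      have : (0 : ℝ) < r := hr
      positivity
  rw [ENNReal.ofReal_rpow_of_nonneg (by positivity) hp.le, ← Real.rpow_mul (by positivity),
    one_div_mul_cancel hp.ne', Real.rpow_one]

theorem hasDerivAt_profile {β lam x : ℝ} (hN : 2 < N) (hβ : 0 < β) (hlam : 0 < lam)
    (hx : 0 < x) :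
    HasDerivAt (fun y : ℝ => ∫ r in Ioi y, r ^ (1 - (N : ℝ)) * Real.exp (-(lam * r ^ β) / β))
      (-((x ^ (N - 1))⁻¹ * Real.exp (-(lam * x ^ β) / β))) x := by
  set g : ℝ → ℝ := fun r => r ^ (1 - (N : ℝ)) * Real.exp (-(lam * r ^ β) / β) with hg
  have hgc : ContinuousOn g (Ioi 0) := (continuousOn_rpow_Ioi _).mul
    (((((continuousOn_rpow_Ioi β).const_mul lam).neg).div_const β).rexp)
  have h2 : HasDerivAt (fun y => ∫ t in x..y, g t) (g x) x :=
    intervalIntegral.integral_hasDerivAt_right (by simp)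
      (hgc.stronglyMeasurableAtFilter isOpen_Ioi x hx) (hgc.continuousAt (Ioi_mem_nhds hx))
  have h3 : (x ^ (N - 1))⁻¹ * Real.exp (-(lam * x ^ β) / β) = g x := by
    simp only [hg]
    rw [show 1 - (N : ℝ) = -((N - 1 : ℕ) : ℝ) by
      rw [Nat.cast_sub NeZero.one_le]; ring, Real.rpow_neg hx.le, Real.rpow_natCast]
  rw [h3]
  refine (h2.const_sub (∫ r in Ioi x, g r)).congr_of_eventuallyEq ?_
  filter_upwards [Ioi_mem_nhds hx] with y hy
  rw [← intervalIntegral.integral_interval_add_Ioi (integrableOn_profile hN hβ hlam hx)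
    (integrableOn_profile hN hβ hlam hy)]
  ring

/-- The stability inequality for a given weak gradient and a given weak Laplacian. -/
theorem exists_stability {p a b : ℝ} (hN : 2 < N) (hp : 2 ≤ p) (hβ : 0 < b - a + 1)
    (hθ : 0 < -b - (p - 1) * a - (p - 1) * (N - 1)) :
    ∃ C : ℝ, 0 < C ∧ ∀ (u L : 𝔼 → ℝ) (G : 𝔼 → 𝔼), HasWeakLaplacian u L → HasWeakGradient u G →
      IsRadial u → weightedNorm p b L ≠ ⊤ → weightedNorm p a G ≠ ⊤ →
      hNorm p (((p - 1) * a + b + 1) / p) u ≠ ⊤ ∧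
      (-b - (p - 1) * a - (p - 1) * (N - 1)) / p *
          (hNorm p (((p - 1) * a + b + 1) / p) u).toReal ^ p +
        C * (⨅ v ∈ minimizers N a b,
          hNorm p (((p - 1) * a + b + 1) / p) (u - v) ^ p).toReal ≤
        (weightedNorm p b L).toReal * (weightedNorm p a G).toReal ^ (p - 1) := by
  have hp0 : 0 < p := by linarith
  set β := b - a + 1 with hβdef
  set θ := -b - (p - 1) * a - (p - 1) * (N - 1) with hθdef
  set c := ((p - 1) * a + b + 1) / p with hc
  have hpc : p * c = (p - 1) * a + b + 1 := by rw [hc]; field_simp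
  set m : ℕ := N - 1 with hm
  have hmN : (m : ℝ) = N - 1 := by rw [hm, Nat.cast_sub NeZero.one_le]; simp
  obtain ⟨C, hC, H⟩ := exists_stability_half_line hp hθ hβ
  refine ⟨C, hC, fun u L G hL hG hu hLt hGt => ?_⟩
  have hLm := aestronglyMeasurable_of_locallyIntegrableOn_compl hL.2.1
  have hGm := aestronglyMeasurable_of_locallyIntegrableOn_compl hG.2.1
  have hLi := integrable_of_weightedNorm_ne_top hp0 b hLm hLt
  have hGi := integrable_of_weightedNorm_ne_top hp0 a hGm hGt
  set S := (volume : Measure 𝔼).toSphere.real univ with hS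
  have hS0 : 0 < S := sphere_real_pos
  obtain ⟨f, w, hw, hf, huf, hgw⟩ := exists_radial_profile hL hG hu
  set k : ℝ → ℝ := fun r => r ^ m * sphereMean volume L r with hk
  -- Powers of `r`.
  have hpow : ∀ (q : ℝ) (r y : ℝ), 0 < r →
      r ^ m * (r ^ q * |(r ^ m)⁻¹ * y| ^ p) = r ^ (q + m - p * m) * |y| ^ p := by
    intro q r y hr
    rw [abs_mul, abs_of_pos (by positivity : 0 < (r ^ m)⁻¹), Real.mul_rpow (by positivity)
      (abs_nonneg _), ← Real.rpow_natCast, ← Real.rpow_neg hr.le, ← Real.rpow_mul hr.le,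
      ← mul_assoc, ← mul_assoc, ← Real.rpow_add hr, ← Real.rpow_add hr]
    congr 2
    ring
  have hLmean := (locallyIntegrableOn_sphereMean (μ := (volume : Measure 𝔼)) hL.2.1)
  have hgl := locallyIntegrableOn_radialComponent hG.2.1
  have hgm := aestronglyMeasurable_radialComponent hGm
  -- The Laplacian.
  obtain ⟨hAi, hAle⟩ := integral_abs_sphereMean_rpow_le (p := p) (by linarith) (-(p * b)) hLm
    (by simpa only [Real.norm_eq_abs] using hLi) hLmean.aestronglyMeasurable
  -- The exponents match because `θ + β - 1 = -pa - (p-1)(N-1)` and `p(1-β) = pa - pb`.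
  have eA : EqOn (fun r => r ^ m * (r ^ (-(p * b)) * |sphereMean volume L r| ^ p))
      (fun r => r ^ (θ + β - 1) * |r ^ (1 - β) * k r| ^ p) (Ioi 0) := fun r hr => by
    have hr0 : (0 : ℝ) < r := hr
    have e1 : sphereMean volume L r = (r ^ m)⁻¹ * k r := by
      simp only [hk]; rw [inv_mul_cancel_left₀ (by positivity)]
    simp only
    rw [e1, hpow _ _ _ hr0, abs_mul (r ^ (1 - β)), abs_of_pos (by positivity : 0 < r ^ (1 - β)),
      Real.mul_rpow (by positivity) (abs_nonneg _), ← Real.rpow_mul hr0.le, ← mul_assoc,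
      ← Real.rpow_add hr0]
    congr 2
    rw [hθdef, hβdef, hmN]; ring
  rw [finrank_euclideanSpace_fin] at hAi hAle
  have hAi' := hAi.congr_fun eA measurableSet_Ioi
  rw [setIntegral_congr_fun measurableSet_Ioi eA] at hAle
  -- The gradient.
  have hgle : ∀ x : 𝔼, ‖x‖ ^ (-(p * a)) * |radialComponent G x| ^ p ≤
      ‖x‖ ^ (-(p * a)) * ‖G x‖ ^ p := fun x => by
    gcongr
    exact abs_radialComponent_le G x
  have hgi : Integrable (fun x : 𝔼 => ‖x‖ ^ (-(p * a)) * |radialComponent G x| ^ p) := by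
    refine hGi.mono' ?_ (.of_forall fun x => ?_)
    · exact (measurable_norm.pow_const _).aestronglyMeasurable.mul
        (hgm.norm.aemeasurable.pow_const p).aestronglyMeasurable
    · rw [Real.norm_of_nonneg (by positivity)]
      exact hgle x
  obtain ⟨hBi, hBle⟩ := integral_abs_sphereMean_rpow_le (p := p) (by linarith) (-(p * a)) hgm
    hgi (locallyIntegrableOn_sphereMean hgl).aestronglyMeasurable
  have eB : (fun r => r ^ m * (r ^ (-(p * a)) * |sphereMean volume (radialComponent G) r| ^ p))
      =ᵐ[volume.restrict (Ioi 0)] fun r => r ^ (θ + β - 1) * |w r| ^ p := by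
    filter_upwards [hgw, ae_restrict_mem measurableSet_Ioi] with r hr hr0
    have hr0 : (0 : ℝ) < r := hr0
    rw [hr, hpow _ _ _ hr0]
    congr 2
    rw [hθdef, hβdef, hmN]; ring
  rw [finrank_euclideanSpace_fin] at hBi hBle
  have hBi' : IntegrableOn (fun r => r ^ (θ + β - 1) * |w r| ^ p) (Ioi 0) := hBi.congr eB
  rw [integral_congr_ae eB] at hBle
  have hBle' := hBle.trans (integral_mono hgi hGi hgle)
  -- The one-dimensional inequality.
  obtain ⟨hDi, Λ, lam, hlam, hIi, hmain⟩ := H w k hw hAi' hBi'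
  have eD : ∀ y : ℝ → ℝ, EqOn (fun r => r ^ (θ - 1) * |y r| ^ p)
      (fun r => r ^ m * (r ^ (-(p * c)) * |(r ^ m)⁻¹ * y r| ^ p)) (Ioi 0) := fun y r hr => by
    have hr0 : (0 : ℝ) < r := hr
    simp only
    rw [hpow _ _ _ hr0]
    congr 2
    rw [hpc, hθdef, hmN]; ring
  have hminv : ContinuousOn (fun r : ℝ => (r ^ m)⁻¹) (Ioi 0) := (contDiffOn_pow_inv m).continuousOn
  have hwc := hw.continuousOn
  have hexpc : ContinuousOn (fun r : ℝ => Real.exp (-(lam * r ^ β) / β)) (Ioi 0) :=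
    (((((continuousOn_rpow_Ioi β).const_mul lam).neg).div_const β).rexp)
  have hDle := hNorm_rpow_le_of_radial hp0 c hf (hminv.mul hwc) huf
    (hDi.congr_fun (eD w) measurableSet_Ioi)
  rw [← setIntegral_congr_fun measurableSet_Ioi (eD w)] at hDle
  -- The sign compensates for differentiating in the lower limit: the profile of `v` has derivative
  -- `r^(1-N) Λ exp(-λ r^β/β)`.
  set v : 𝔼 → ℝ := fun x => -Λ * ∫ r in Ioi ‖x‖,
    r ^ (1 - (N : ℝ)) * Real.exp (-(lam * r ^ β) / β) with hv
  have hvm : v ∈ minimizers N a b := ⟨-Λ, lam, hlam, rfl⟩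
  have huv := hNorm_rpow_le_of_radial (u := u - v) (p := p) hp0 c
    (f := fun r => f r - -Λ * ∫ t in Ioi r,
      t ^ (1 - (N : ℝ)) * Real.exp (-(lam * t ^ β) / β))
    (f' := fun r => (r ^ m)⁻¹ * (w r - Λ * Real.exp (-(lam * r ^ β) / β)))
    (fun r hr => ((hf r hr).sub ((hasDerivAt_profile hN hβ hlam hr).const_mul (-Λ))).congr_deriv
      (by ring))
    (hminv.mul (hwc.sub (hexpc.const_mul Λ)))
    (huf.mono fun x hx => by simp only [Pi.sub_apply, hx, hv])
    (hIi.congr_fun (eD _) measurableSet_Ioi)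
  rw [← setIntegral_congr_fun measurableSet_Ioi (eD _)] at huv
  set A := ∫ r in Ioi (0 : ℝ), r ^ (θ + β - 1) * |r ^ (1 - β) * k r| ^ p with hA
  set B := ∫ r in Ioi (0 : ℝ), r ^ (θ + β - 1) * |w r| ^ p with hB
  set D := ∫ r in Ioi (0 : ℝ), r ^ (θ - 1) * |w r| ^ p with hD
  set I := ∫ r in Ioi (0 : ℝ), r ^ (θ - 1) * |w r - Λ * Real.exp (-(lam * r ^ β) / β)| ^ p with hI
  have nonneg : ∀ (q : ℝ) (g : ℝ → ℝ), 0 ≤ ∫ r in Ioi (0 : ℝ), r ^ q * |g r| ^ p := fun q g =>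
    setIntegral_nonneg measurableSet_Ioi fun r hr => by
      have : (0 : ℝ) < r := hr
      positivity
  have hA0 : 0 ≤ A := nonneg _ _
  have hB0 : 0 ≤ B := nonneg _ _
  have hD0 : 0 ≤ D := nonneg _ _
  have hI0 : 0 ≤ I := nonneg _ _
  refine ⟨?_, ?_⟩
  · intro htop
    rw [htop, ENNReal.top_rpow_of_pos hp0] at hDle
    exact ENNReal.ofReal_ne_top (top_le_iff.1 hDle)
  · have h1 : (hNorm p c u).toReal ^ p ≤ S * D := by
      rw [ENNReal.toReal_rpow]
      exact ENNReal.toReal_le_of_le_ofReal (by positivity) hDle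
    have h2 : (⨅ v ∈ minimizers N a b, hNorm p c (u - v) ^ p).toReal ≤ S * I :=
      ENNReal.toReal_le_of_le_ofReal (by positivity) ((iInf₂_le v hvm).trans huv)
    have h3 : (weightedNorm p b L).toReal * (weightedNorm p a G).toReal ^ (p - 1) =
        (∫ x : 𝔼, ‖x‖ ^ (-(p * b)) * |L x| ^ p) ^ (1 / p) *
        (∫ x : 𝔼, ‖x‖ ^ (-(p * a)) * ‖G x‖ ^ p) ^ (1 - 1 / p) := by
      have n1 : 0 ≤ ∫ x : 𝔼, ‖x‖ ^ (-(p * b)) * ‖L x‖ ^ p := integral_nonneg fun x => by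
        positivity
      have n2 : 0 ≤ ∫ x : 𝔼, ‖x‖ ^ (-(p * a)) * ‖G x‖ ^ p := integral_nonneg fun x => by
        positivity
      rw [weightedNorm_eq hp0 b hLm hLi, weightedNorm_eq hp0 a hGm hGi,
        ENNReal.toReal_ofReal (by positivity), ENNReal.toReal_ofReal (by positivity),
        ← Real.rpow_mul n2]
      simp only [Real.norm_eq_abs]
      congr 2
      field_simp
    rw [h3]
    have h1p : 0 ≤ 1 - 1 / p := by
      rw [sub_nonneg, div_le_one hp0]; linarith
    calc θ / p * (hNorm p c u).toReal ^ p +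
          C * (⨅ v ∈ minimizers N a b, hNorm p c (u - v) ^ p).toReal
        ≤ θ / p * (S * D) + C * (S * I) := by gcongr
      _ = S * (θ / p * D + C * I) := by ring
      _ ≤ S * (A ^ (1 / p) * B ^ (1 - 1 / p)) := by gcongr
      -- The exponents sum to one, so the area `S` distributes exactly over both factors.
      _ = (S * A) ^ (1 / p) * (S * B) ^ (1 - 1 / p) := by
        rw [Real.mul_rpow hS0.le hA0, Real.mul_rpow hS0.le hB0]
        have : S ^ (1 / p) * S ^ (1 - 1 / p) = S := by
          rw [← Real.rpow_add hS0]; simp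
        linear_combination (-(A ^ (1 / p) * B ^ (1 - 1 / p))) * this
      _ ≤ _ := by gcongr

end Euclidean

end CKN

/-! ### The theorem -/

theorem theorem1p7 (N : ℕ) (p a b c K : ℝ) (hN : 1 ≤ N) (hp : 2 ≤ p) (hpN : p < N)
    (hb₁ : 1 - (N : ℝ) ≤ b) (hb₂ : b < N * (1 - p) / p) (hab : 0 < b - a + 1)
    (hpab : b + (p - 1) * a + 1 = N * p * b / (N - p) + p ^ 2 * (N - 1) / (N - p))
    (hc : c = ((p - 1) * a + b + 1) / p)
    (hK : K = (-b - (p - 1) * a - (p - 1) * (N - 1)) / p) :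
    ∃ C : ℝ, 0 < C ∧ ∀ u : EuclideanSpace ℝ (Fin N) → ℝ,
      CKN.MemSecondOrderSpace p p b a u → CKN.IsRadial u →
        CKN.hNorm p c u ≠ ⊤ ∧
        (CKN.laplacianNorm p b u).toReal * (CKN.hNorm p a u).toReal ^ (p - 1)
            - K * (CKN.hNorm p c u).toReal ^ p
          ≥ C * (⨅ v ∈ CKN.minimizers N a b, CKN.hNorm p c (u - v) ^ p).toReal := by
  have hp0 : 0 < p := by linarith
  have hN2 : 2 < N := by exact_mod_cast hp.trans_lt hpN
  have : NeZero N := ⟨by omega⟩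
  have hNp : (0 : ℝ) < N - p := by linarith
  have hθ : 0 < -b - (p - 1) * a - (p - 1) * ((N : ℝ) - 1) := by
    rw [lt_div_iff₀ hp0] at hb₂
    rw [← add_div, eq_div_iff hNp.ne'] at hpab
    refine pos_of_mul_pos_left (b := (N : ℝ) - p) ?_ hNp.le
    -- The balance condition eliminates `a`, and what remains is positive by the upper bound on `b`.
    have h1 : (-b - (p - 1) * a - (p - 1) * ((N : ℝ) - 1)) * (N - p) =
        N * (N * (1 - p) - b * p) := by
      linear_combination (-1) * hpab
    rw [h1]
    exact mul_pos (by linarith) (by linarith)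
  obtain ⟨C, hC, H⟩ := CKN.exists_stability (N := N) hN2 hp hab hθ
  rw [← hc, ← hK] at H
  refine ⟨C, hC, fun u hu hrad => ?_⟩
  obtain ⟨hX, hY⟩ := hu.ne_top (by linarith)
  -- The norms of `Δu` and `∇u` are infima over weak derivatives, so the inequality is applied to an
  -- `L` and a `G` within `ε` of them, and `ε` tends to zero at the end; `C` does not depend on that
  -- choice.
  have key : ∀ ε : ℝ, 0 < ε → CKN.hNorm p c u ≠ ⊤ ∧
      K * (CKN.hNorm p c u).toReal ^ p +
        C * (⨅ v ∈ CKN.minimizers N a b, CKN.hNorm p c (u - v) ^ p).toReal ≤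
      ((CKN.laplacianNorm p b u).toReal + ε) * ((CKN.hNorm p a u).toReal + ε) ^ (p - 1) := by
    intro ε hε
    have hε' : ENNReal.ofReal ε ≠ 0 := (ENNReal.ofReal_pos.2 hε).ne'
    have hX' := ENNReal.lt_add_right hX hε'
    have hY' := ENNReal.lt_add_right hY hε'
    obtain ⟨L, hL, hLlt⟩ : ∃ L, ∃ _ : CKN.HasWeakLaplacian u L, CKN.weightedNorm p b L <
        CKN.laplacianNorm p b u + ENNReal.ofReal ε := by
      simpa only [iInf_lt_iff] using (show (⨅ (L) (_ : CKN.HasWeakLaplacian u L),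
        CKN.weightedNorm p b L) < _ from hX')
    obtain ⟨G, hG, hGlt⟩ : ∃ G, ∃ _ : CKN.HasWeakGradient u G, CKN.weightedNorm p a G <
        CKN.hNorm p a u + ENNReal.ofReal ε := by
      simpa only [iInf_lt_iff] using (show (⨅ (G) (_ : CKN.HasWeakGradient u G),
        CKN.weightedNorm p a G) < _ from hY')
    obtain ⟨h1, h2⟩ := H u L G hL hG hrad hLlt.ne_top hGlt.ne_top
    have toReal_le : ∀ {x y : ℝ≥0∞}, y ≠ ⊤ → x < y + ENNReal.ofReal ε →
        x.toReal ≤ y.toReal + ε := fun {x y} hy hxy => by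
      have := ENNReal.toReal_mono (ENNReal.add_ne_top.2 ⟨hy, ENNReal.ofReal_ne_top⟩) hxy.le
      rwa [ENNReal.toReal_add hy ENNReal.ofReal_ne_top, ENNReal.toReal_ofReal hε.le] at this
    refine ⟨h1, h2.trans ?_⟩
    have hp1 : 0 ≤ p - 1 := by linarith
    gcongr
    · exact toReal_le hX hLlt
    · exact toReal_le hY hGlt
  refine ⟨(key 1 one_pos).1, ?_⟩
  have hlim : Tendsto (fun ε : ℝ => ((CKN.laplacianNorm p b u).toReal + ε) *
      ((CKN.hNorm p a u).toReal + ε) ^ (p - 1)) (𝓝[>] 0)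
      (𝓝 (((CKN.laplacianNorm p b u).toReal + 0) *
        ((CKN.hNorm p a u).toReal + 0) ^ (p - 1))) := by
    refine Tendsto.mono_left (Continuous.tendsto ?_ 0) nhdsWithin_le_nhds
    exact (continuous_const.add continuous_id).mul
      ((continuous_const.add continuous_id).rpow_const fun _ => Or.inr (by linarith))
  have := ge_of_tendsto hlim (eventually_mem_nhdsWithin.mono fun ε hε => (key ε hε).2)
  simp only [add_zero] at this
  linarith
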